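/- Let $r\ge 1$ and $n\ge 1$ be integers and write $[n]=\{1,\dots,n\}$. An $r$-partition of $[n]$ is a set $\{(B_{i1},\dots,B_{ir}) : 1\le i\le k\}$ of $r$-tuples of nonempty subsets of $[n]$ such that for each $j$ the sets $B_{1j},\dots,B_{kj}$ form a partition of $[n]$ into $k$ blocks, and $|B_{i1}|=\dots=|B_{ir}|$ for each $i$. Let $\mathsf Q_n^{(r)}$ be the poset of all $r$-partitions of $[n]$ ordered by refinement: $\pi\le\sigma$ if every tuple of $\pi$ is contained, entry by entry, in a tuple of $\sigma$. Let $M(n)$ be the number of minimal elements of $\mathsf Q_n^{(r)}$ for $n\ge1$, put $M(0)=1$, and define the numbers $r_n(\mathsf Q_n^{(r)})$ by $$\sum_{n\ge 1} r_n(\mathsf Q_n^{(r)})\frac{z^n}{n!\,M(n)}=-\log\Bigl(\sum_{n\ge 0}(-1)^n\frac{z^n}{n!\,M(n)}\Bigr).$$ Call two $r$-tuples $a,b$ of positive integers crossing unless $a_k<b_k$ for all $k$ or $b_k<a_k$ for all $k$. A heap (of such tuples) is a finite poset whose elements are labelled by $r$-tuples of positive integers, such that any two elements with crossing labels are comparable,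 and whenever $y$ covers $x$ the labels of $x$ and $y$ are crossing. Heaps are considered up to label-preserving isomorphism of posets. A pyramid is a heap with exactly one maximal element. For an $(r-1)$-tuple $\sigma=(\sigma_1,\dots,\sigma_{r-1})$ of permutations of $[n]$, the path of $\sigma$ starting from $m\in[n]$ is $(m,\sigma_1(m),\sigma_2\sigma_1(m),\dots,\sigma_{r-1}\cdots\sigma_1(m))$. A non-ambiguous tree of size $N$ is a set $A$ of $N$ points of $\mathbb N\times\mathbb N$ (with $0\in\mathbb N$) such that: $(0,0)\in A$; for every $p=(p_1,p_2)\in A$ other than $(0,0)$, either there is $q\in A$ with $q_1=p_1$, $q_2<p_2$, or there is $s\in A$ with $s_2=p_2$, $s_1<p_1$, but not both; and if some point of $A$ has first coordinate $x$ (respectively second coordinate $y$), then every $x'<x$ (respectively $y'<y$) is the first (respectively second) coordinate of a point of $A$. The parent of a point $p\neq(0,0)$ is the nearest such point $q$ or $s$. The tree is complete if every point of $A$ has exactly $0$ or $2$ children. **Theorem.** The number of pyramids that have exactly $n$ elements, labelled by the $n$ paths of some $(r-1)$-tuple of permutations of $[n]$ (each path occurring once), and whose unique maximal element is the path starting from $1$,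 is finite and equal to $r_n(\mathsf Q_n^{(r)})$. In particular, $r_n(\mathsf Q_n^{(2)})$ is the (finite) number of complete non-ambiguous trees of size $2n-1$, and there is a bijection between the set of these trees and the set of the above pyramids for $r=2$. -/

import Mathlib

noncomputable section

namespace PathHeap

/-! ### The numbers `r_n(Q_n)` attached to a sequence of posets -/

/-- `M(n)`: the number of minimal elements of `Q n` for `n ≥ 1`, and `M(0) = 1`. -/
def numMinimal (Q : ℕ → Type) [∀ n, PartialOrder (Q n)] (n : ℕ) : ℕ :=
  if n = 0 then 1 else Nat.card {q : Q n // IsMin q}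

/-- The power series `∑_{n ≥ 0} (-1)^n z^n / (n! M(n))`. -/
def alternatingSeries (Q : ℕ → Type) [∀ n, PartialOrder (Q n)] : PowerSeries ℚ :=
  PowerSeries.mk fun n => (-1 : ℚ) ^ n / ((n.factorial : ℚ) * (numMinimal Q n : ℚ))

/-- The series has constant term `1`, so that its logarithm is defined by substitution. -/
theorem hasSubst_alternatingSeries_sub_one (Q : ℕ → Type) [∀ n, PartialOrder (Q n)] :
    PowerSeries.HasSubst (alternatingSeries Q - 1) := by
  apply PowerSeries.HasSubst.of_constantCoeff_zero'
  rw [map_sub, alternatingSeries, ← PowerSeries.coeff_zero_eq_constantCoeff_apply,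
    PowerSeries.coeff_mk]
  simp [numMinimal]

/-- The formal power series `-log (∑_{n ≥ 0} (-1)^n z^n / (n! M(n)))`;
`PowerSeries.log ℚ` is the series `log (1 + X)`. -/
def negLogSeries (Q : ℕ → Type) [∀ n, PartialOrder (Q n)] : PowerSeries ℚ :=
  -(PowerSeries.log ℚ).subst (alternatingSeries Q - 1)

/-- The number `r_n(Q_n)`, defined by
`∑_{n ≥ 1} r_n(Q_n) z^n / (n! M(n)) = -log (∑_{n ≥ 0} (-1)^n z^n / (n! M(n)))`. -/
def rNumber (Q : ℕ → Type) [∀ n, PartialOrder (Q n)] (n : ℕ) : ℚ :=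
  (n.factorial : ℚ) * (numMinimal Q n : ℚ) * PowerSeries.coeff n (negLogSeries Q)

/-! ### The poset of `r`-partitions of an `n`-element set -/

/-- An `r`-partition of `[n]`: a set of `r`-tuples of nonempty subsets of `[n]`, the `r` entries of
a tuple having the same cardinality, such that for every `j` the `j`-th entries of the tuples
partition `[n]` (different tuples giving different blocks). -/
@[ext]
structure RPartition (r n : ℕ) where
  parts : Finset (Fin r → Finset (Fin n))
  nonempty : ∀ b ∈ parts, ∀ j, (b j).Nonempty
  existsUnique_mem : ∀ (j : Fin r) (s : Fin n), ∃! b, b ∈ parts ∧ s ∈ b j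
  card_eq : ∀ b ∈ parts, ∀ i j, (b i).card = (b j).card

/-- Refinement: `π ≤ ρ` if every tuple of `π` is contained, entry by entry, in a tuple of `ρ`. -/
instance (r n : ℕ) : PartialOrder (RPartition r n) where
  le π ρ := ∀ b ∈ π.parts, ∃ c ∈ ρ.parts, ∀ j, b j ⊆ c j
  le_refl π b hb := ⟨b, hb, fun _ => Finset.Subset.refl _⟩
  le_trans π ρ τ h₁ h₂ b hb := by
    obtain ⟨c, hc, hbc⟩ := h₁ b hb
    obtain ⟨d, hd, hcd⟩ := h₂ c hc
    exact ⟨d, hd, fun j => (hbc j).trans (hcd j)⟩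
  le_antisymm := by
    have key : ∀ π ρ : RPartition r n, (∀ b ∈ π.parts, ∃ c ∈ ρ.parts, ∀ j, b j ⊆ c j) →
        (∀ b ∈ ρ.parts, ∃ c ∈ π.parts, ∀ j, b j ⊆ c j) → π.parts ⊆ ρ.parts := by
      intro π ρ h₁ h₂ b hb
      obtain ⟨c, hc, hbc⟩ := h₁ b hb
      obtain ⟨d, hd, hcd⟩ := h₂ c hc
      have hbc' : b = c := by
        funext j
        obtain ⟨s, hs⟩ := π.nonempty b hb j
        have hbd : b = d :=
          (π.existsUnique_mem j s).unique ⟨hb, hs⟩ ⟨hd, hcd j (hbc j hs)⟩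
        exact Finset.Subset.antisymm (hbc j) (hbd ▸ hcd j)
      exact hbc' ▸ hc
    intro π ρ h₁ h₂
    exact RPartition.ext (Finset.Subset.antisymm (key π ρ h₁ h₂) (key ρ π h₂ h₁))

/-! ### Heaps and pyramids -/

/-- A heap with pieces in `B` for the relation `R`: a finite poset labelled by `B` such that
elements with related labels are comparable, and a covering relation only occurs between elements
with related labels. -/
structure Heap (B : Type) (R : B → B → Prop) where
  carrier : Type
  [order : PartialOrder carrier]
  [finite : Finite carrier]
  label : carrier → B
  comparable : ∀ x y : carrier, R (label x) (label y) → x ≤ y ∨ y ≤ x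
  related_of_covBy : ∀ x y : carrier, x ⋖ y → R (label x) (label y)

attribute [instance] Heap.order Heap.finite

variable {B : Type} {R : B → B → Prop}

/-- Two heaps are identified when there is an order isomorphism preserving the labels. -/
instance Heap.setoid (B : Type) (R : B → B → Prop) : Setoid (Heap B R) where
  r H K := ∃ e : H.carrier ≃o K.carrier, ∀ x, K.label (e x) = H.label x
  iseqv :=
    { refl := fun H => ⟨OrderIso.refl _, fun _ => rfl⟩
      symm := fun {H K} ⟨e, he⟩ => ⟨e.symm, fun x => by rw [← he, e.apply_symm_apply]⟩
      trans := fun {H K L} ⟨e, he⟩ ⟨f, hf⟩ =>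
        ⟨e.trans f, fun x => by rw [OrderIso.trans_apply, hf, he]⟩ }

/-- The set of heaps with pieces in `B`, up to isomorphism. -/
def HeapClass (B : Type) (R : B → B → Prop) : Type 1 :=
  Quotient (Heap.setoid B R)

/-- A pyramid is a heap with exactly one maximal element. -/
def Heap.IsPyramid (H : Heap B R) : Prop :=
  ∃! x : H.carrier, IsMax x

/-! ### Crossing paths -/

/-- Two paths do not cross if and only if one of them is strictly smaller in every entry. -/
def Crossing {r : ℕ} (a b : Fin r → ℕ+) : Prop :=
  ¬((∀ k, a k < b k) ∨ (∀ k, b k < a k))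

theorem crossing_refl {r : ℕ} (hr : 1 ≤ r) (a : Fin r → ℕ+) : Crossing a a := by
  rintro (h | h) <;> exact lt_irrefl _ (h ⟨0, hr⟩)

theorem Crossing.symm {r : ℕ} {a b : Fin r → ℕ+} (h : Crossing a b) : Crossing b a :=
  fun h' => h h'.symm

/-- The vertex of the path of `(σ₁, …, σ_{r-1})` starting at `m` after `k` steps,
that is, `σ_k ⋯ σ₁ (m)`. Here `[n]` is indexed from `0` and `σ i` stands for `σ_{i+1}`. -/
def pathVertex {r n : ℕ} (σ : Fin (r - 1) → Equiv.Perm (Fin n)) (m : Fin n) : ℕ → Fin n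
  | 0 => m
  | k + 1 => if h : k < r - 1 then σ ⟨k, h⟩ (pathVertex σ m k) else pathVertex σ m k

/-- The path `(m, σ₁ (m), σ₂ σ₁ (m), …, σ_{r-1} ⋯ σ₁ (m))`, the elements of `[n]` being
written as the positive integers `1, …, n`. -/
def path {r n : ℕ} (σ : Fin (r - 1) → Equiv.Perm (Fin n)) (m : Fin n) : Fin r → ℕ+ :=
  fun k => (pathVertex σ m k).val.succPNat

/-- `H` is a pyramid whose elements are exactly the `n` paths (each occurring once) of an
`(r-1)`-tuple `σ` of permutations of `[n]`, and its maximal element is the path of `σ` starting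
at `1` (index `0` of `Fin n`). -/
def IsPathPyramid (r n : ℕ) (H : Heap (Fin r → ℕ+) Crossing) : Prop :=
  H.IsPyramid ∧ ∃ σ : Fin (r - 1) → Equiv.Perm (Fin n),
    Function.Injective H.label ∧ Set.range H.label = Set.range (path σ) ∧
      ∃ (x : H.carrier) (m : Fin n), IsMax x ∧ m.val = 0 ∧ H.label x = path σ m

/-- The pyramids of `IsPathPyramid`, up to isomorphism of heaps. -/
def PathPyramid (r n : ℕ) : Type 1 :=
  {q : HeapClass (Fin r → ℕ+) Crossing //
    ∃ H : Heap (Fin r → ℕ+) Crossing, IsPathPyramid r n H ∧ Quotient.mk _ H = q}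

/-! ### Complete non-ambiguous trees -/

/-- A non-ambiguous tree: a finite set of points of the grid such that the root `(0, 0)` belongs
to it, every other point has a point of the set before it in its column or in its row but not in
both, and no line between two given points is empty. -/
structure IsNonAmbiguousTree (A : Finset (ℕ × ℕ)) : Prop where
  root_mem : (0, 0) ∈ A
  xor_before : ∀ p ∈ A, p ≠ (0, 0) →
    Xor (∃ q ∈ A, q.2 < p.2 ∧ q.1 = p.1) (∃ s ∈ A, s.1 < p.1 ∧ s.2 = p.2)
  no_gap_fst : ∀ p ∈ A, ∀ x' < p.1, ∃ q ∈ A, q.1 = x'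
  no_gap_snd : ∀ p ∈ A, ∀ y' < p.2, ∃ q ∈ A, q.2 = y'

/-- `p` is a child of `q` in the tree underlying `A`: `q` is the nearest point of `A` before `p`
in the same column, or the nearest point of `A` before `p` in the same row. -/
def IsChild (A : Finset (ℕ × ℕ)) (p q : ℕ × ℕ) : Prop :=
  p ∈ A ∧ q ∈ A ∧
    ((q.1 = p.1 ∧ q.2 < p.2 ∧ ∀ t ∈ A, t.1 = p.1 → t.2 < p.2 → t.2 ≤ q.2) ∨
      (q.2 = p.2 ∧ q.1 < p.1 ∧ ∀ t ∈ A, t.2 = p.2 → t.1 < p.1 → t.1 ≤ q.1))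

/-- A complete non-ambiguous tree: every vertex has either `0` or `2` children. -/
def IsCompleteNonAmbiguousTree (A : Finset (ℕ × ℕ)) : Prop :=
  IsNonAmbiguousTree A ∧
    ∀ v ∈ A, Set.ncard {p | IsChild A p v} = 0 ∨ Set.ncard {p | IsChild A p v} = 2

/-- The complete non-ambiguous trees of size (number of points) `N`. -/
def CompleteNonAmbiguousTree (N : ℕ) : Type :=
  {A : Finset (ℕ × ℕ) // IsCompleteNonAmbiguousTree A ∧ A.card = N}

end PathHeap

end

noncomputable section

namespace PathHeap

/-! ### Recursions for the numbers `r_n(Q_n)` -/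

/-! Put r = s + 1, F = ∑ (-1)^n z^n / (n! M(n)) and L = -log F. A minimal r-partition consists of
tuples of singletons, that is, of s permutations once the first entries are used as indices; hence
M(n) = n!^s. The equation L' F = -F' then becomes the linear recursion ∑_i C(n,i) C(n+1,i+1)^s
(-1)^(n-i) r_(i+1) = (-1)^n, which determines the numbers r_n. It remains to show that the pyramids
satisfy it.

A heap with distinct labels is the same as an acyclic orientation of the crossing graph on its label
set P, and its maximal elements are the sinks. The sets of paths of permutations are the "systems":
sets of tuples whose entries in each position run bijectively through [n]. For a vertex v of a graph
on P, the sum of (-1)^|T| over independent T avoiding v and acyclic orientations of P \ T with no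
sink except v vanishes unless P is independent (`sum_neg_one_pow_mul_card_pyramidOrientations`).
Indeed, if T is restored as a set of sources, then for a fixed orientation of P the set T runs
through an interval of the Boolean lattice, and the signs cancel.

Now sum over all systems P on given sets S k. An independent system is totally ordered entrywise, so
it is determined by the sets of its entries (`IsSystem.eq_chain`). The only variable data are
therefore the entry sets of P \ T, whose numbers are the binomials above. This gives the recursion
(`sum_pyramidNumber`).

For r = 2 the series F satisfies Bessel's equation (z F')' = -F, so z L' satisfies a Riccati
equation, which is a quadratic recursion for r_n. Deleting the root of a complete non-ambiguous tree
splits its rows and columns between two smaller trees, and this yields the same recursion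
(`card_treesOn`). Trees and pyramids are thus equinumerous, and the bijection comes from the
equality of finite cardinalities. -/

open PowerSeries in
theorem constantCoeff_alternatingSeries (Q : ℕ → Type) [∀ n, PartialOrder (Q n)] :
    constantCoeff (alternatingSeries Q) = 1 := by
  rw [alternatingSeries, ← coeff_zero_eq_constantCoeff_apply, coeff_mk]
  simp [numMinimal]

-- Chain rule for log (1 + X), whose derivative ∑ (-1)^n X^n is the inverse of 1 + X. This form
-- avoids dividing by F.
open PowerSeries in
theorem derivative_negLogSeries_mul (Q : ℕ → Type) [∀ n, PartialOrder (Q n)] :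
    derivative ℚ (negLogSeries Q) * alternatingSeries Q =
      -derivative ℚ (alternatingSeries Q) := by
  have hs := hasSubst_alternatingSeries_sub_one Q
  have hgeom : (mk fun n ↦ algebraMap ℚ ℚ ((-1 : ℚ) ^ n)) * (1 + X : ℚ⟦X⟧) = 1 := by
    ext n
    rcases n with _ | n
    · simp
    · rw [mul_add, map_add, mul_one, coeff_succ_mul_X, coeff_mk, coeff_mk, coeff_one]
      simp [pow_succ]
  have hgeom' := congrArg (PowerSeries.subst (alternatingSeries Q - 1)) hgeom
  rw [subst_mul hs, subst_add hs, subst_X hs, ← coe_substAlgHom hs, map_one,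
    add_sub_cancel] at hgeom'
  rw [negLogSeries, map_neg, derivative_subst hs, deriv_log, neg_mul, map_sub,
    ← coe_substAlgHom hs]
  have h1 : derivative ℚ (1 : ℚ⟦X⟧) = 0 := by simp
  rw [h1, sub_zero, mul_right_comm, hgeom', one_mul]

theorem coeff_negLogSeries (Q : ℕ → Type) [∀ n, PartialOrder (Q n)] (s : ℕ)
    (hQ : ∀ n, numMinimal Q n = n.factorial ^ s) (n : ℕ) :
    PowerSeries.coeff n (negLogSeries Q) = rNumber Q n / (n.factorial : ℚ) ^ (s + 1) := by
  have : (n.factorial : ℚ) ≠ 0 := by exact_mod_cast n.factorial_ne_zero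
  rw [rNumber, hQ]
  push_cast
  field_simp
  ring

theorem coeff_alternatingSeries (Q : ℕ → Type) [∀ n, PartialOrder (Q n)] (s : ℕ)
    (hQ : ∀ n, numMinimal Q n = n.factorial ^ s) (n : ℕ) :
    PowerSeries.coeff n (alternatingSeries Q) = (-1) ^ n / (n.factorial : ℚ) ^ (s + 1) := by
  rw [alternatingSeries, PowerSeries.coeff_mk, hQ]
  push_cast
  ring

/-- The linear recursion obtained from `F L' = -F'`, where `L = -log F`. -/
theorem rNumber_linear_recursion (Q : ℕ → Type) [∀ n, PartialOrder (Q n)] (s : ℕ)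
    (hQ : ∀ n, numMinimal Q n = n.factorial ^ s) (n : ℕ) :
    ∑ ij ∈ Finset.HasAntidiagonal.antidiagonal n,
      (n.choose ij.1 : ℚ) * ((n + 1).choose (ij.1 + 1) : ℚ) ^ s * (-1) ^ ij.2 *
        rNumber Q (ij.1 + 1) = (-1) ^ n := by
  have h := congrArg (PowerSeries.coeff n) (derivative_negLogSeries_mul Q)
  rw [PowerSeries.coeff_mul, map_neg, PowerSeries.coeff_derivative,
    coeff_alternatingSeries Q s hQ] at h
  have hf : ∀ k : ℕ, (k.factorial : ℚ) ≠ 0 := fun k => by exact_mod_cast k.factorial_ne_zero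
  -- The factor n! (n+1)!^s turns the quotients of factorials into one C(n,i) and s copies of
  -- C(n+1,i+1).
  have h' := congrArg (fun x => (n.factorial : ℚ) * ((n + 1).factorial : ℚ) ^ s * x) h
  simp only [Finset.mul_sum] at h'
  have e1 : (n.factorial : ℚ) * ((n + 1).factorial : ℚ) ^ s *
      -((-1) ^ (n + 1) / ((n + 1).factorial : ℚ) ^ (s + 1) * (n + 1)) = (-1) ^ n := by
    have := hf n
    have h2 : ((n : ℚ) + 1) ≠ 0 := by positivity
    rw [Nat.factorial_succ]
    push_cast
    rw [pow_succ, pow_succ]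
    field_simp
  rw [e1] at h'
  rw [← h']
  refine Finset.sum_congr rfl ?_
  rintro ⟨i, j⟩ hij
  rw [Finset.HasAntidiagonal.mem_antidiagonal] at hij
  dsimp only at hij ⊢
  subst hij
  rw [PowerSeries.coeff_derivative, coeff_negLogSeries Q s hQ, coeff_alternatingSeries Q s hQ,
    Nat.cast_choose ℚ (Nat.le_add_right i j), Nat.cast_choose ℚ (by omega : i + 1 ≤ i + j + 1),
    Nat.add_sub_cancel_left, show i + j + 1 - (i + 1) = j by omega]
  have hi := hf i
  have hj := hf j
  have hi' := hf (i + 1)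
  have e2 : ((i + 1).factorial : ℚ) = (i + 1) * i.factorial := by
    rw [Nat.factorial_succ]; push_cast; ring
  have h2 : ((i : ℚ) + 1) ≠ 0 := by positivity
  rw [pow_succ ((i + 1).factorial : ℚ) s, pow_succ (j.factorial : ℚ) s, div_pow, mul_pow]
  field_simp
  rw [e2]
  ring

open PowerSeries in
/-- The quadratic recursion, coming from Bessel's differential equation for `F`. -/
theorem rNumber_quadratic_recursion (Q : ℕ → Type) [∀ n, PartialOrder (Q n)]
    (hQ : ∀ n, numMinimal Q n = n.factorial ^ 1) (n : ℕ) :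
    rNumber Q (n + 1) = (if n = 0 then 1 else 0) + ∑ ij ∈ Finset.HasAntidiagonal.antidiagonal n,
      (n.choose ij.1 : ℚ) * (n.choose (ij.1 + 1) : ℚ) * rNumber Q (ij.1 + 1) *
        rNumber Q ij.2 := by
  have hf : ∀ k : ℕ, (k.factorial : ℚ) ≠ 0 := fun k => by exact_mod_cast k.factorial_ne_zero
  have hfs : ∀ k : ℕ, ((k + 1).factorial : ℚ) = (k + 1) * k.factorial := fun k => by
    rw [Nat.factorial_succ]; push_cast; ring
  have hF := derivative_negLogSeries_mul Q
  -- The coefficients a_k = (-1)^k / k!^2 satisfy (k+1)^2 a_(k+1) = -a_k.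
  have hbessel : derivative ℚ (X * derivative ℚ (alternatingSeries Q)) =
      -alternatingSeries Q := by
    ext k
    have h2 : ((k : ℚ) + 1) ≠ 0 := by positivity
    have := hf k
    rw [coeff_derivative, coeff_succ_X_mul, coeff_derivative, map_neg,
      coeff_alternatingSeries Q 1 hQ, coeff_alternatingSeries Q 1 hQ, hfs]
    field_simp
    ring
  set F := alternatingSeries Q
  set L' := derivative ℚ (negLogSeries Q) with hL'
  have hF0 : F ≠ 0 := by
    intro h
    have := constantCoeff_alternatingSeries Q
    rw [show alternatingSeries Q = 0 from h] at this
    simp at this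
  -- Substituting X F' = -F (X L') into Bessel's equation gives F times the Riccati equation; the
  -- factor F is then cancelled in the domain of power series.
  have hmul : F * (derivative ℚ (X * L') - L' * (X * L') - 1) = 0 := by
    have e : X * derivative ℚ F = -(F * (X * L')) := by
      linear_combination X * hF
    rw [e, map_neg, Derivation.leibniz, smul_eq_mul, smul_eq_mul] at hbessel
    linear_combination -hbessel - (X * L') * hF
  have hode : derivative ℚ (X * L') = 1 + L' * (X * L') := by
    have := (mul_eq_zero.mp hmul).resolve_left hF0
    linear_combination this
  have h := congrArg (coeff n) hode
  have hL : ∀ k, coeff k L' = rNumber Q (k + 1) / ((k + 1).factorial : ℚ) ^ (1 + 1) * (k + 1) := by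
    intro k
    rw [hL', coeff_derivative, coeff_negLogSeries Q 1 hQ]
  have hXL : ∀ k, coeff k (X * L') = rNumber Q k / (k.factorial : ℚ) ^ (1 + 1) * k := by
    intro k
    rcases k with _ | k
    · simp
    · rw [coeff_succ_X_mul, hL]; push_cast; rfl
  rw [coeff_derivative, hXL, map_add, coeff_mul, coeff_one] at h
  have h' := congrArg (fun x => (n.factorial : ℚ) ^ 2 * x) h
  have e1 : (n.factorial : ℚ) ^ 2 * (rNumber Q (n + 1) / ((n + 1).factorial : ℚ) ^ (1 + 1) *
      ((n + 1 : ℕ) : ℚ) * (n + 1)) = rNumber Q (n + 1) := by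
    have := hf n
    have h2 : ((n : ℚ) + 1) ≠ 0 := by positivity
    rw [hfs]
    push_cast
    field_simp
  rw [e1, mul_add, Finset.mul_sum] at h'
  rw [h']
  congr 1
  · split_ifs with h0
    · simp [h0]
    · simp
  · refine Finset.sum_congr rfl ?_
    rintro ⟨i, j⟩ hij
    rw [Finset.HasAntidiagonal.mem_antidiagonal] at hij
    dsimp only at hij ⊢
    rw [hL, hXL]
    -- For j = 0 both sides vanish: C(n,n+1) = 0, and the coefficient of X L' carries the factor j.
    rcases j with _ | j
    · rw [show n.choose (i + 1) = 0 from Nat.choose_eq_zero_of_lt (by omega)]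
      simp
    subst hij
    rw [Nat.cast_choose ℚ (by omega : i ≤ i + (j + 1)),
      Nat.cast_choose ℚ (by omega : i + 1 ≤ i + (j + 1)),
      Nat.add_sub_cancel_left, show i + (j + 1) - (i + 1) = j by omega]
    have hi := hf i
    have hj := hf j
    have h2 : ((i : ℚ) + 1) ≠ 0 := by positivity
    have h3 : ((j : ℚ) + 1) ≠ 0 := by positivity
    rw [hfs i, hfs j]
    push_cast
    field_simp

/-! ### The minimal `r`-partitions -/

namespace RPartition

variable {r n : ℕ}

/-- The `r`-partition into the tuples of singletons `({g₁ m}, …, {g_r m})`. -/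
def ofPerms (g : Fin r → Equiv.Perm (Fin n)) : RPartition r n where
  parts := Finset.univ.image fun m j => {g j m}
  nonempty := by
    intro b hb j
    obtain ⟨m, -, rfl⟩ := Finset.mem_image.mp hb
    exact Finset.singleton_nonempty _
  existsUnique_mem := by
    intro j s
    refine ⟨fun j' => {g j' ((g j).symm s)}, ⟨Finset.mem_image_of_mem _ (Finset.mem_univ _),
      by simp⟩, ?_⟩
    rintro b ⟨hb, hs⟩
    obtain ⟨m, -, rfl⟩ := Finset.mem_image.mp hb
    rw [Finset.mem_singleton] at hs
    simp [hs]
  card_eq := by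
    intro b hb i j
    obtain ⟨m, -, rfl⟩ := Finset.mem_image.mp hb
    simp

theorem mem_parts_ofPerms {g : Fin r → Equiv.Perm (Fin n)} {b : Fin r → Finset (Fin n)} :
    b ∈ (ofPerms g).parts ↔ ∃ m, (fun j => {g j m}) = b := by
  simp [ofPerms]

/-- A nonempty subset of a singleton is the whole singleton, so a tuple below a tuple of singletons
is equal to it. -/
theorem isMin_ofPerms (hr : 0 < r) (g : Fin r → Equiv.Perm (Fin n)) : IsMin (ofPerms g) := by
  intro ρ hρ c hc
  obtain ⟨m, rfl⟩ := mem_parts_ofPerms.mp hc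
  obtain ⟨b, ⟨hb, hmb⟩, -⟩ := ρ.existsUnique_mem ⟨0, hr⟩ (g ⟨0, hr⟩ m)
  refine ⟨b, hb, fun j => ?_⟩
  obtain ⟨d, hd, hbd⟩ := hρ b hb
  obtain ⟨m', rfl⟩ := mem_parts_ofPerms.mp hd
  have hm := hbd _ hmb
  rw [Finset.mem_singleton, EmbeddingLike.apply_eq_iff_eq] at hm
  subst hm
  obtain ⟨x, hx⟩ := ρ.nonempty b hb j
  have := hbd j hx
  rw [Finset.mem_singleton] at this
  rw [Finset.singleton_subset_iff, ← this]
  exact hx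

/-- The tuple of an `r`-partition whose `j`-th entry contains `s`. -/
def blockOf (π : RPartition r n) (j : Fin r) (s : Fin n) : {b // b ∈ π.parts} :=
  ⟨(π.existsUnique_mem j s).choose, (π.existsUnique_mem j s).choose_spec.1.1⟩

theorem mem_blockOf (π : RPartition r n) (j : Fin r) (s : Fin n) : s ∈ (π.blockOf j s).1 j :=
  (π.existsUnique_mem j s).choose_spec.1.2

theorem blockOf_eq_iff (π : RPartition r n) (j : Fin r) (s : Fin n) (b : {b // b ∈ π.parts}) :
    π.blockOf j s = b ↔ s ∈ b.1 j :=
  ⟨fun h => h ▸ π.mem_blockOf j s, fun h => Subtype.ext <|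
    (π.existsUnique_mem j s).unique ⟨(π.blockOf j s).2, π.mem_blockOf j s⟩ ⟨b.2, h⟩⟩

/-- The entries of a tuple are equinumerous, so each first entry can be matched with the `j`-th
entry of the same tuple; over all tuples these matchings glue to a permutation. Consequently there
are no other minimal elements. -/
theorem exists_ofPerms_le (π : RPartition (r + 1) n) :
    ∃ f : Fin r → Equiv.Perm (Fin n), ofPerms (Fin.cons 1 f) ≤ π := by
  have key : ∀ j : Fin r, ∃ e : Equiv.Perm (Fin n),
      ∀ m, π.blockOf j.succ (e m) = π.blockOf 0 m := by
    intro j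
    have h : ∀ b, Nonempty ({m // π.blockOf 0 m = b} ≃ {m // π.blockOf j.succ m = b}) := by
      intro b
      refine ⟨Fintype.equivOfCardEq ?_⟩
      rw [Fintype.card_of_subtype (b.1 0) fun x => (blockOf_eq_iff π 0 x b).symm,
        Fintype.card_of_subtype (b.1 j.succ) fun x => (blockOf_eq_iff π j.succ x b).symm]
      exact π.card_eq b.1 b.2 _ _
    exact ⟨Equiv.ofFiberEquiv fun b => (h b).some, fun m => Equiv.ofFiberEquiv_map _ m⟩
  choose f hf using key
  refine ⟨f, fun b hb => ?_⟩
  obtain ⟨m, rfl⟩ := mem_parts_ofPerms.mp hb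
  refine ⟨(π.blockOf 0 m).1, (π.blockOf 0 m).2, fun j => ?_⟩
  rw [Finset.singleton_subset_iff]
  refine Fin.cases ?_ (fun j => ?_) j
  · simpa using π.mem_blockOf 0 m
  · rw [Fin.cons_succ, ← hf j m]
    exact π.mem_blockOf _ _

/-- Taking the first permutation to be the identity removes the freedom of reindexing: a tuple is
found again from its first entry. -/
theorem ofPerms_cons_injective : Function.Injective fun f : Fin r → Equiv.Perm (Fin n) =>
    ofPerms (Fin.cons 1 f : Fin (r + 1) → Equiv.Perm (Fin n)) := by
  intro f f' h
  funext j
  ext m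
  have hm : (fun i => {(Fin.cons 1 f : Fin (r + 1) → Equiv.Perm (Fin n)) i m}) ∈
      (ofPerms (Fin.cons 1 f' : Fin (r + 1) → Equiv.Perm (Fin n))).parts := by
    rw [← show ofPerms (Fin.cons 1 f : Fin (r + 1) → Equiv.Perm (Fin n)) =
      ofPerms (Fin.cons 1 f') from h]
    exact mem_parts_ofPerms.mpr ⟨m, rfl⟩
  obtain ⟨m', hm'⟩ := mem_parts_ofPerms.mp hm
  have h0 := congrFun hm' 0
  have hj := congrFun hm' j.succ
  simp only [Fin.cons_zero, Fin.cons_succ, Equiv.Perm.coe_one, id_eq,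
    Finset.singleton_inj] at h0 hj
  rw [← hj, h0]

theorem card_isMin (r n : ℕ) :
    Nat.card {π : RPartition (r + 1) n // IsMin π} = n.factorial ^ r := by
  rw [← Nat.card_eq_of_bijective (fun f : Fin r → Equiv.Perm (Fin n) =>
    (⟨ofPerms (Fin.cons 1 f), isMin_ofPerms r.succ_pos _⟩ :
      {π : RPartition (r + 1) n // IsMin π})) ⟨?_, ?_⟩]
  · simp [Fintype.card_perm]
  · intro f f' h
    exact ofPerms_cons_injective (congrArg Subtype.val h)
  · rintro ⟨π, hπ⟩
    obtain ⟨f, hf⟩ := exists_ofPerms_le π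
    exact ⟨f, Subtype.ext (le_antisymm hf (hπ hf))⟩

end RPartition

theorem numMinimal_rPartition (r n : ℕ) :
    numMinimal (RPartition (r + 1)) n = n.factorial ^ r := by
  rw [numMinimal]
  split_ifs with h
  · simp [h]
  · exact RPartition.card_isMin r n

/-! ### Acyclic orientations with a prescribed sink -/

section Orientation

-- The sets between `U` and `W` are the sets `U ∪ T'` with `T' ⊆ W \ U`, and the alternating sum
-- over `T'` vanishes unless `W \ U` is empty.
open scoped Classical in
theorem sum_powerset_neg_one_pow_card_between {B : Type} [DecidableEq B] {U W Z : Finset B}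
    (hW : W ⊆ Z) :
    (∑ T ∈ Z.powerset with U ⊆ T ∧ T ⊆ W, (-1 : ℤ) ^ T.card) =
      if U = W then (-1) ^ U.card else 0 := by
  by_cases hUW : U ⊆ W
  · have h : (∑ T ∈ Z.powerset with U ⊆ T ∧ T ⊆ W, (-1 : ℤ) ^ T.card) =
        ∑ T ∈ (W \ U).powerset, (-1 : ℤ) ^ U.card * (-1) ^ T.card := by
      refine Finset.sum_nbij' (fun T => T \ U) (fun T => T ∪ U) ?_ ?_ ?_ ?_ ?_
      · intro T hT
        simp only [Finset.mem_filter, Finset.mem_powerset] at hT ⊢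
        exact Finset.sdiff_subset_sdiff hT.2.2 subset_rfl
      · intro T hT
        simp only [Finset.mem_filter, Finset.mem_powerset] at hT ⊢
        have : T ∪ U ⊆ W := Finset.union_subset (hT.trans Finset.sdiff_subset) hUW
        exact ⟨this.trans hW, Finset.subset_union_right, this⟩
      · intro T hT
        simp only [Finset.mem_filter, Finset.mem_powerset] at hT
        exact Finset.sdiff_union_of_subset hT.2.1
      · intro T hT
        rw [Finset.mem_powerset] at hT
        exact Finset.union_sdiff_cancel_right (Finset.disjoint_of_subset_left hT
          Finset.sdiff_disjoint)
      · intro T hT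
        simp only [Finset.mem_filter, Finset.mem_powerset] at hT
        rw [← pow_add, add_comm, Finset.card_sdiff_add_card_eq_card hT.2.1]
    rw [h, ← Finset.mul_sum, Finset.sum_powerset_neg_one_pow_card]
    by_cases hWU : W ⊆ U
    · rw [if_pos (Finset.sdiff_eq_empty_iff_subset.mpr hWU), if_pos (hUW.antisymm hWU), mul_one]
    · rw [if_neg (mt Finset.sdiff_eq_empty_iff_subset.mp hWU), if_neg fun h => hWU h.symm.subset,
        mul_zero]
  · rw [if_neg fun h => hUW h.subset, Finset.filter_false_of_mem, Finset.sum_empty]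
    exact fun T _ h => hUW (h.1.trans h.2)

variable {B : Type} {R : B → B → Prop}

/-- `E` orients every edge `{a, b}` of the graph induced by `R` on `P`, without oriented cycles. -/
structure IsAcyclicOrientation (R : B → B → Prop) (P : Finset B) (E : Finset (B × B)) : Prop where
  subset : E ⊆ P ×ˢ P
  rel : ∀ a b, (a, b) ∈ E → R a b
  total : ∀ a ∈ P, ∀ b ∈ P, a ≠ b → R a b → (a, b) ∈ E ∨ (b, a) ∈ E
  rank : ∃ f : B → ℕ, ∀ a b, (a, b) ∈ E → f a < f b

theorem IsAcyclicOrientation.left_mem {P : Finset B} {E : Finset (B × B)}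
    (h : IsAcyclicOrientation R P E) {a b : B} (hab : (a, b) ∈ E) : a ∈ P :=
  (Finset.mem_product.mp (h.subset hab)).1

theorem IsAcyclicOrientation.right_mem {P : Finset B} {E : Finset (B × B)}
    (h : IsAcyclicOrientation R P E) {a b : B} (hab : (a, b) ∈ E) : b ∈ P :=
  (Finset.mem_product.mp (h.subset hab)).2

open scoped Classical in
/-- The acyclic orientations of the graph induced by `R` on `P`. -/
def acyclicOrientations (R : B → B → Prop) (P : Finset B) : Finset (Finset (B × B)) :=
  {E ∈ (P ×ˢ P).powerset | IsAcyclicOrientation R P E}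

theorem mem_acyclicOrientations {P : Finset B} {E : Finset (B × B)} :
    E ∈ acyclicOrientations R P ↔ IsAcyclicOrientation R P E := by
  classical
  rw [acyclicOrientations, Finset.mem_filter, Finset.mem_powerset]
  exact ⟨fun h => h.2, fun h => ⟨h.subset, h⟩⟩

open scoped Classical in
/-- The acyclic orientations of the graph induced by `R` on `P` having no sink except possibly
`v`. -/
def pyramidOrientations (R : B → B → Prop) (v : B) (P : Finset B) : Finset (Finset (B × B)) :=
  {E ∈ acyclicOrientations R P | ∀ a ∈ P, a ≠ v → ∃ b, (a, b) ∈ E}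

theorem mem_pyramidOrientations {v : B} {P : Finset B} {E : Finset (B × B)} :
    E ∈ pyramidOrientations R v P ↔
      IsAcyclicOrientation R P E ∧ ∀ a ∈ P, a ≠ v → ∃ b, (a, b) ∈ E := by
  classical
  rw [pyramidOrientations, Finset.mem_filter, mem_acyclicOrientations]

/-- No two distinct elements of `T` are related. -/
def Independent (R : B → B → Prop) (T : Finset B) : Prop :=
  ∀ a ∈ T, ∀ b ∈ T, a ≠ b → ¬R a b

variable [DecidableEq B]

theorem IsAcyclicOrientation.filter_notMem {P T : Finset B} {E : Finset (B × B)}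
    (h : IsAcyclicOrientation R P E) (hT : ∀ a b, (a, b) ∈ E → b ∉ T) :
    IsAcyclicOrientation R (P \ T) {e ∈ E | e.1 ∉ T} where
  subset := by
    rintro ⟨a, b⟩ he
    rw [Finset.mem_filter] at he
    simp only [Finset.mem_product, Finset.mem_sdiff]
    exact ⟨⟨h.left_mem he.1, he.2⟩, h.right_mem he.1, hT a b he.1⟩
  rel a b he := h.rel a b (Finset.mem_filter.mp he).1
  total := by
    intro a ha b hb hab hR
    rw [Finset.mem_sdiff] at ha hb
    simp only [Finset.mem_filter]
    exact (h.total a ha.1 b hb.1 hab hR).imp (fun h => ⟨h, ha.2⟩) fun h => ⟨h, hb.2⟩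
  rank := h.rank.imp fun f hf a b he => hf a b (Finset.mem_filter.mp he).1

open scoped Classical in
/-- Add to an orientation of `P \ T` the edges leaving `T`. -/
def addSources (R : B → B → Prop) (P T : Finset B) (E : Finset (B × B)) : Finset (B × B) :=
  E ∪ {e ∈ T ×ˢ (P \ T) | R e.1 e.2}

theorem mem_addSources {P T : Finset B} {E : Finset (B × B)} {a b : B} :
    (a, b) ∈ addSources R P T E ↔ (a, b) ∈ E ∨ (a ∈ T ∧ b ∈ P ∧ b ∉ T ∧ R a b) := by
  simp only [addSources, Finset.mem_union, Finset.mem_filter, Finset.mem_product,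
    Finset.mem_sdiff]
  tauto

theorem IsAcyclicOrientation.addSources (hR : ∀ a b, R a b → R b a) {P T : Finset B}
    {E : Finset (B × B)} (hTP : T ⊆ P) (hT : Independent R T)
    (h : IsAcyclicOrientation R (P \ T) E) :
    IsAcyclicOrientation R P (addSources R P T E) where
  subset := by
    rintro ⟨a, b⟩ he
    rw [Finset.mem_product]
    rcases mem_addSources.mp he with he | ⟨ha, hb, -, -⟩
    · exact ⟨(Finset.mem_sdiff.mp (h.left_mem he)).1, (Finset.mem_sdiff.mp (h.right_mem he)).1⟩
    · exact ⟨hTP ha, hb⟩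
  rel := by
    intro a b he
    rcases mem_addSources.mp he with he | ⟨-, -, -, he⟩
    · exact h.rel a b he
    · exact he
  total := by
    intro a ha b hb hab hRab
    simp only [mem_addSources]
    by_cases haT : a ∈ T <;> by_cases hbT : b ∈ T
    · exact absurd hRab (hT a haT b hbT hab)
    · exact .inl (.inr ⟨haT, hb, hbT, hRab⟩)
    · exact .inr (.inr ⟨hbT, ha, haT, hR a b hRab⟩)
    · exact (h.total a (Finset.mem_sdiff.mpr ⟨ha, haT⟩) b (Finset.mem_sdiff.mpr ⟨hb, hbT⟩) hab
        hRab).imp .inl .inl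
  rank := by
    obtain ⟨f, hf⟩ := h.rank
    -- The new sources go to level 0, and all other levels are raised by one.
    refine ⟨fun a => if a ∈ T then 0 else f a + 1, fun a b he => ?_⟩
    rcases mem_addSources.mp he with he | ⟨ha, -, hb, -⟩
    · have ha := (Finset.mem_sdiff.mp (h.left_mem he)).2
      have hb := (Finset.mem_sdiff.mp (h.right_mem he)).2
      simpa [ha, hb] using hf a b he
    · simp [ha, hb]

-- When `T` is independent and no edge enters it, every edge meeting `T` leaves it for `P \ T`. The
-- orientation is then determined by its restriction to `P \ T`, and any orientation there extends.
open scoped Classical in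
theorem card_pyramidOrientations_sdiff (hR : ∀ a b, R a b → R b a) {P T : Finset B} {v : B}
    (hTP : T ⊆ P) (hT : Independent R T) :
    (pyramidOrientations R v (P \ T)).card =
      Finset.card {E ∈ acyclicOrientations R P | (∀ a b, (a, b) ∈ E → b ∉ T) ∧
        ∀ a ∈ P, a ∉ T → a ≠ v → ∃ b, (a, b) ∈ E} := by
  have hE : ∀ {E a b}, IsAcyclicOrientation R (P \ T) E → (a, b) ∈ E → a ∉ T ∧ b ∉ T :=
    fun h he => ⟨(Finset.mem_sdiff.mp (h.left_mem he)).2, (Finset.mem_sdiff.mp (h.right_mem he)).2⟩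
  refine Finset.card_nbij' (fun E => addSources R P T E) (fun E => {e ∈ E | e.1 ∉ T}) ?_ ?_ ?_ ?_
  · intro E h
    obtain ⟨h, hv⟩ := mem_pyramidOrientations.mp h
    simp only [Finset.coe_filter, Set.mem_ofPred_eq, mem_acyclicOrientations]
    refine ⟨h.addSources hR hTP hT, fun a b he => ?_, fun a ha haT hav => ?_⟩
    · rcases mem_addSources.mp he with he | ⟨-, -, he, -⟩
      · exact (hE h he).2
      · exact he
    · obtain ⟨b, hb⟩ := hv a (Finset.mem_sdiff.mpr ⟨ha, haT⟩) hav
      exact ⟨b, mem_addSources.mpr (.inl hb)⟩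
  · intro E h
    simp only [Finset.coe_filter, Set.mem_ofPred_eq, mem_acyclicOrientations] at h
    rw [Finset.mem_coe, mem_pyramidOrientations]
    refine ⟨h.1.filter_notMem h.2.1, fun a ha hav => ?_⟩
    rw [Finset.mem_sdiff] at ha
    obtain ⟨b, hb⟩ := h.2.2 a ha.1 ha.2 hav
    exact ⟨b, Finset.mem_filter.mpr ⟨hb, ha.2⟩⟩
  · intro E h
    obtain ⟨h, -⟩ := mem_pyramidOrientations.mp h
    ext ⟨a, b⟩
    rw [Finset.mem_filter, mem_addSources]
    constructor
    · rintro ⟨he | he, ha⟩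
      · exact he
      · exact absurd he.1 ha
    · exact fun he => ⟨.inl he, (hE h he).1⟩
  · intro E h
    simp only [Finset.coe_filter, Set.mem_ofPred_eq, mem_acyclicOrientations] at h
    ext ⟨a, b⟩
    rw [mem_addSources, Finset.mem_filter]
    constructor
    · rintro (he | ⟨ha, hb, hbT, hab⟩)
      · exact he.1
      · refine (h.1.total a (hTP ha) b hb (fun e => hbT (e ▸ ha)) hab).resolve_right
          fun he => h.2.1 b a he ha
    · intro he
      by_cases ha : a ∈ T
      · exact .inr ⟨ha, h.1.right_mem he, h.2.1 a b he, h.1.rel a b he⟩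
      · exact .inl ⟨he, ha⟩

-- If there is an edge, the lowest tail has an outgoing but no incoming edge, and the highest head
-- the reverse. Equality of the two sets forces both vertices to be `v`, which would then both have
-- and lack an incoming edge.
open scoped Classical in
theorem IsAcyclicOrientation.filter_eq_filter_iff {P : Finset B} {v : B} {E : Finset (B × B)}
    (h : IsAcyclicOrientation R P E) :
    ({a ∈ P.erase v | ¬∃ b, (a, b) ∈ E} : Finset B) =
      ({a ∈ P.erase v | ¬∃ b, (b, a) ∈ E} : Finset B) ↔ E = ∅ := by
  refine ⟨fun heq => ?_, fun h => by simp [h]⟩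
  by_contra hne
  have hiff : ∀ a ∈ P, a ≠ v → ((∃ b, (a, b) ∈ E) ↔ ∃ b, (b, a) ∈ E) := by
    intro a ha hav
    have := congrArg (a ∈ ·) heq
    rw [eq_iff_iff, Finset.mem_filter, Finset.mem_filter, Finset.mem_erase] at this
    simpa only [ha, hav, ne_eq, not_false_eq_true, and_self, true_and, not_iff_not] using this
  obtain ⟨f, hf⟩ := h.rank
  have hE := Finset.nonempty_iff_ne_empty.mpr hne
  obtain ⟨⟨a, b⟩, hab, hmin⟩ := E.exists_min_image (fun e => f e.1) hE
  obtain ⟨⟨c, d⟩, hcd, hmax⟩ := E.exists_max_image (fun e => f e.2) hE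
  have ha : ¬∃ b, (b, a) ∈ E := by
    rintro ⟨x, hx⟩
    exact absurd (hmin _ hx) (not_le.mpr (hf _ _ hx))
  have hd : ¬∃ b, (d, b) ∈ E := by
    rintro ⟨x, hx⟩
    exact absurd (hmax _ hx) (not_le.mpr (hf _ _ hx))
  have hav : a = v := by
    by_contra hav
    exact ha ((hiff a (h.left_mem hab) hav).mp ⟨b, hab⟩)
  have hdv : d = v := by
    by_contra hdv
    exact hd ((hiff d (h.right_mem hcd) hdv).mpr ⟨c, hcd⟩)
  exact ha ⟨c, hav ▸ hdv ▸ hcd⟩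

open scoped Classical in
/-- The alternating sum over the independent sets avoiding `v` of the numbers of acyclic
orientations with unique sink `v` of the complement. -/
theorem sum_neg_one_pow_mul_card_pyramidOrientations (hR : ∀ a b, R a b → R b a) {P : Finset B}
    {v : B} (hv : v ∈ P) :
    (∑ T ∈ (P.erase v).powerset with Independent R T,
      (-1 : ℤ) ^ T.card * ((pyramidOrientations R v (P \ T)).card : ℤ)) =
      if Independent R P then (-1) ^ (P.card + 1) else 0 := by
  -- `U E` and `W E` are the sinks and the sources other than `v`. The pair (E, T) is counted
  -- exactly when `U E ⊆ T ⊆ W E`.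
  let U (E : Finset (B × B)) : Finset B := {a ∈ P.erase v | ¬∃ b, (a, b) ∈ E}
  let W (E : Finset (B × B)) : Finset B := {a ∈ P.erase v | ¬∃ b, (b, a) ∈ E}
  have hUW : ∀ E, ∀ T ∈ (P.erase v).powerset, ((∀ a b, (a, b) ∈ E → b ∉ T) ∧
      ∀ a ∈ P, a ∉ T → a ≠ v → ∃ b, (a, b) ∈ E) ↔ U E ⊆ T ∧ T ⊆ W E := by
    intro E T hT
    rw [Finset.mem_powerset] at hT
    simp only [U, W, Finset.subset_iff, Finset.mem_filter, Finset.mem_erase]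
    constructor
    · rintro ⟨h1, h2⟩
      refine ⟨fun a ⟨⟨hav, ha⟩, hn⟩ => ?_, fun a ha => ⟨Finset.mem_erase.mp (hT ha), ?_⟩⟩
      · by_contra haT
        exact hn (h2 a ha haT hav)
      · rintro ⟨b, hb⟩
        exact h1 b a hb ha
    · rintro ⟨h1, h2⟩
      refine ⟨fun a b he hb => (h2 hb).2 ⟨a, he⟩, fun a ha haT hav => ?_⟩
      by_contra hn
      exact haT (h1 ⟨⟨hav, ha⟩, hn⟩)
  have hmain : ∀ T ∈ (P.erase v).powerset, (if Independent R T then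
      (-1 : ℤ) ^ T.card * ((pyramidOrientations R v (P \ T)).card : ℤ) else 0) =
      ∑ E ∈ acyclicOrientations R P, if U E ⊆ T ∧ T ⊆ W E then (-1) ^ T.card else 0 := by
    intro T hT
    have hTP : T ⊆ P := (Finset.mem_powerset.mp hT).trans (Finset.erase_subset _ _)
    split_ifs with hind
    · rw [card_pyramidOrientations_sdiff hR hTP hind, Finset.card_filter, Nat.cast_sum,
        Finset.mul_sum]
      refine Finset.sum_congr rfl fun E _ => ?_
      by_cases h : U E ⊆ T ∧ T ⊆ W E
      · rw [if_pos h, if_pos ((hUW E T hT).mpr h)]; simp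
      · rw [if_neg h, if_neg (mt (hUW E T hT).mp h)]; simp
    -- If `T` is not independent, an edge inside `T` would enter `T`, so no orientation contributes
    -- and the independence condition can be dropped.
    · symm
      refine Finset.sum_eq_zero fun E hE => if_neg fun h => hind ?_
      have h1 := ((hUW E T hT).mpr h).1
      intro a ha b hb hab hRab
      rcases (mem_acyclicOrientations.mp hE).total a (hTP ha) b (hTP hb) hab hRab with he | he
      · exact h1 _ _ he hb
      · exact h1 _ _ he ha
  rw [Finset.sum_filter, Finset.sum_congr rfl hmain, Finset.sum_comm]
  have hinner : ∀ E ∈ acyclicOrientations R P,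
      (∑ T ∈ (P.erase v).powerset, if U E ⊆ T ∧ T ⊆ W E then (-1 : ℤ) ^ T.card else 0) =
        if E = ∅ then (-1) ^ (P.card + 1) else 0 := by
    intro E hE
    rw [← Finset.sum_filter,
      sum_powerset_neg_one_pow_card_between (Finset.filter_subset _ _)]
    -- Without edges every vertex other than `v` is a sink, and the sign is (-1)^(|P| - 1) =
    -- (-1)^(|P| + 1).
    by_cases hE0 : E = ∅
    · rw [if_pos hE0, if_pos (((mem_acyclicOrientations.mp hE).filter_eq_filter_iff).mpr hE0),
        ← Finset.card_erase_add_one hv, add_assoc, pow_add]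
      simp [U, hE0]
    · rw [if_neg hE0, if_neg (mt ((mem_acyclicOrientations.mp hE).filter_eq_filter_iff).mp hE0)]
  rw [Finset.sum_congr rfl hinner, Finset.sum_ite_eq']
  refine if_congr ?_ rfl rfl
  rw [mem_acyclicOrientations]
  constructor
  · intro h a ha b hb hab hRab
    simpa using h.total a ha b hb hab hRab
  · intro h
    exact ⟨by simp, by simp, fun a ha b hb hab hRab => absurd hRab (h a ha b hb hab),
      fun _ => 0, by simp⟩

end Orientation

/-! ### Systems of paths -/

section Rank

variable {α : Type} [LinearOrder α]

/-- The number of elements of `X` below `x`. -/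
def rankIn (X : Finset α) (x : α) : ℕ := Finset.card {y ∈ X | y < x}

theorem rankIn_lt_rankIn {X : Finset α} {x y : α} (hx : x ∈ X) (h : x < y) :
    rankIn X x < rankIn X y := by
  refine Finset.card_lt_card (Finset.ssubset_iff_of_subset ?_ |>.mpr ⟨x, ?_, ?_⟩)
  · intro z hz
    rw [Finset.mem_filter] at hz ⊢
    exact ⟨hz.1, hz.2.trans h⟩
  · exact Finset.mem_filter.mpr ⟨hx, h⟩
  · simp

theorem lt_of_rankIn_lt_rankIn {X : Finset α} {x y : α} (hy : y ∈ X)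
    (h : rankIn X x < rankIn X y) : x < y := by
  by_contra hxy
  rcases (not_lt.mp hxy).eq_or_lt with rfl | hlt
  · exact lt_irrefl _ h
  · exact lt_asymm h (rankIn_lt_rankIn hy hlt)

theorem rankIn_injOn (X : Finset α) : Set.InjOn (rankIn X) X := by
  intro x hx y hy h
  rcases lt_trichotomy x y with hlt | heq | hlt
  · exact absurd h (rankIn_lt_rankIn hx hlt).ne
  · exact heq
  · exact absurd h (rankIn_lt_rankIn hy hlt).ne'

theorem image_rankIn (X : Finset α) : X.image (rankIn X) = Finset.range X.card := by
  refine Finset.eq_of_subset_of_card_le ?_ ?_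
  · intro i hi
    obtain ⟨x, hx, rfl⟩ := Finset.mem_image.mp hi
    rw [Finset.mem_range]
    refine Finset.card_lt_card (Finset.ssubset_iff_of_subset (Finset.filter_subset _ _) |>.mpr
      ⟨x, hx, ?_⟩)
    simp
  · rw [Finset.card_range, Finset.card_image_of_injOn (rankIn_injOn X)]

end Rank

section System

variable {s : ℕ}

/-- The `k`-th entries of the tuples of `P` run through `S k`, for each `k`. -/
def IsSystem (S : Fin (s + 1) → Finset ℕ+) (P : Finset (Fin (s + 1) → ℕ+)) : Prop :=
  ∀ k, Set.BijOn (fun b => b k) (P : Set (Fin (s + 1) → ℕ+)) (S k)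

open scoped Classical in
/-- The finite set of all systems on `S`. -/
def systems (S : Fin (s + 1) → Finset ℕ+) : Finset (Finset (Fin (s + 1) → ℕ+)) :=
  {P ∈ (Fintype.piFinset S).powerset | IsSystem S P}

theorem mem_systems {S : Fin (s + 1) → Finset ℕ+} {P : Finset (Fin (s + 1) → ℕ+)} :
    P ∈ systems S ↔ IsSystem S P := by
  classical
  rw [systems, Finset.mem_filter, Finset.mem_powerset]
  exact ⟨fun h => h.2, fun h =>
    ⟨fun b hb => Fintype.mem_piFinset.mpr fun k => (h k).mapsTo hb, h⟩⟩

variable {S S' : Fin (s + 1) → Finset ℕ+} {P P' T : Finset (Fin (s + 1) → ℕ+)}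

theorem IsSystem.image_eq (h : IsSystem S P) (k : Fin (s + 1)) :
    P.image (fun b => b k) = S k := by
  apply Finset.coe_injective
  rw [Finset.coe_image]
  exact (h k).image_eq

theorem IsSystem.card_eq (h : IsSystem S P) (k : Fin (s + 1)) : (S k).card = P.card := by
  rw [← h.image_eq k, Finset.card_image_of_injOn (h k).injOn]

theorem IsSystem.of_subset (h : IsSystem S P) (hT : T ⊆ P) :
    IsSystem (fun k => T.image fun b => b k) T := by
  intro k
  rw [Finset.coe_image]
  exact ((h k).injOn.mono (Finset.coe_subset.mpr hT)).bijOn_image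

/-- The entry sets of `T` are written as complements of those of `P \ T`, because the latter are the
variables kept in `sum_pyramidNumber`. -/
theorem IsSystem.sdiff (h : IsSystem S P) (hT : T ⊆ P) :
    IsSystem (fun k => S k \ (P \ T).image fun b => b k) T := by
  have := h.of_subset hT
  refine fun k => ?_
  have e : S k \ ((P \ T).image fun b => b k) = T.image fun b => b k := by
    ext x
    simp only [← h.image_eq k, Finset.mem_sdiff, Finset.mem_image, not_exists, not_and]
    constructor
    · rintro ⟨⟨b, hb, rfl⟩, h2⟩
      refine ⟨b, ?_, rfl⟩
      by_contra hbT
      exact h2 b ⟨hb, hbT⟩ rfl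
    · rintro ⟨b, hb, rfl⟩
      refine ⟨⟨b, hT hb, rfl⟩, fun c hc hcb => hc.2 ?_⟩
      rwa [(h k).injOn hc.1 (hT hb) hcb]
  dsimp only
  rw [e]
  exact this k

theorem IsSystem.disjoint (h' : IsSystem S' P') (hT : IsSystem (fun k => S k \ S' k) T) :
    Disjoint P' T := by
  rw [Finset.disjoint_left]
  intro b hb hbT
  exact (Finset.mem_sdiff.mp ((hT 0).mapsTo hbT)).2 ((h' 0).mapsTo hb)

theorem IsSystem.union (hS : ∀ k, S' k ⊆ S k) (h' : IsSystem S' P')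
    (hT : IsSystem (fun k => S k \ S' k) T) : IsSystem S (P' ∪ T) := by
  intro k
  have h1 := h' k
  have h2 := hT k
  rw [Finset.coe_union, show S k = S' k ∪ (S k \ S' k) from
    (Finset.union_sdiff_of_subset (hS k)).symm, Finset.coe_union]
  refine h1.union h2 ((Set.injOn_union ?_).mpr ⟨h1.injOn, h2.injOn, ?_⟩)
  · exact_mod_cast h'.disjoint hT
  · intro a ha b hb hab
    refine (Finset.mem_sdiff.mp (h2.mapsTo hb)).2 ?_
    rw [← hab]
    exact h1.mapsTo ha

/-- The tuples formed by elements of the same rank in each of the sets `S k`. -/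
def chain (S : Fin (s + 1) → Finset ℕ+) : Finset (Fin (s + 1) → ℕ+) :=
  {b ∈ Fintype.piFinset S | ∀ k l, rankIn (S k) (b k) = rankIn (S l) (b l)}

theorem mem_chain {b : Fin (s + 1) → ℕ+} : b ∈ chain S ↔
    (∀ k, b k ∈ S k) ∧ ∀ k l, rankIn (S k) (b k) = rankIn (S l) (b l) := by
  rw [chain, Finset.mem_filter, Fintype.mem_piFinset]

/-- Sets of equal size have the same range of ranks, so each element of `S k` has a partner of the
same rank in every `S l`. -/
theorem isSystem_chain (hS : ∀ k l, (S k).card = (S l).card) : IsSystem S (chain S) := by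
  intro k
  refine ⟨fun b hb => (mem_chain.mp hb).1 k, fun a ha b hb hab => ?_, fun x hx => ?_⟩
  · obtain ⟨ha, ha'⟩ := mem_chain.mp ha
    obtain ⟨hb, hb'⟩ := mem_chain.mp hb
    funext l
    refine rankIn_injOn (S l) (ha l) (hb l) ?_
    rw [ha' l k, hb' l k]
    dsimp only at hab
    rw [hab]
  · have h : ∀ l, ∃ y ∈ S l, rankIn (S l) y = rankIn (S k) x := by
      intro l
      rw [← Finset.mem_image, image_rankIn, hS l k, ← image_rankIn]
      exact Finset.mem_image_of_mem _ hx
    choose b hb hbx using h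
    exact ⟨b, mem_chain.mpr ⟨hb, fun k l => by rw [hbx, hbx]⟩,
      rankIn_injOn (S k) (hb k) hx (hbx k)⟩

theorem independent_chain (S : Fin (s + 1) → Finset ℕ+) : Independent Crossing (chain S) := by
  intro a ha b hb hab hcr
  obtain ⟨ha, ha'⟩ := mem_chain.mp ha
  obtain ⟨hb, hb'⟩ := mem_chain.mp hb
  refine hcr ?_
  rcases lt_trichotomy (rankIn (S 0) (a 0)) (rankIn (S 0) (b 0)) with h | h | h
  · exact .inl fun k => lt_of_rankIn_lt_rankIn (hb k) (by rwa [ha' k 0, hb' k 0])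
  · exact absurd (funext fun k => rankIn_injOn (S k) (ha k) (hb k) (by rw [ha' k 0, hb' k 0, h]))
      hab
  · exact .inr fun k => lt_of_rankIn_lt_rankIn (ha k) (by rwa [ha' k 0, hb' k 0])

/-- Pairwise non-crossing tuples are totally ordered, with the same order in every entry. The rank
of `a k` in `S k` is therefore the number of tuples below `a`, whatever `k` is. -/
theorem IsSystem.eq_chain (h : IsSystem S T) (hT : Independent Crossing T) : T = chain S := by
  have hS : ∀ k l, (S k).card = (S l).card := fun k l => by rw [h.card_eq, h.card_eq]
  refine Finset.eq_of_subset_of_card_le (fun a ha => ?_) ?_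
  · have hlt : ∀ b ∈ T, ∀ k l, b k < a k → b l < a l := by
      intro b hb k l hk
      by_cases hab : b = a
      · exact absurd hk (by simp [hab])
      · rcases not_not.mp (hT b hb a ha hab) with h' | h'
        · exact h' l
        · exact absurd hk (lt_asymm (h' k))
    have hrank : ∀ k, rankIn (S k) (a k) = Finset.card {b ∈ T | b k < a k} := by
      intro k
      rw [rankIn, ← h.image_eq k, Finset.filter_image, Finset.card_image_of_injOn]
      exact (h k).injOn.mono (Finset.coe_subset.mpr (Finset.filter_subset _ _))
    refine mem_chain.mpr ⟨fun k => (h k).mapsTo ha, fun k l => ?_⟩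
    rw [hrank, hrank]
    exact congrArg _ (Finset.filter_congr fun b hb => ⟨hlt b hb k l, hlt b hb l k⟩)
  · rw [← h.card_eq 0, ← (isSystem_chain hS).card_eq 0]

open scoped Classical in
/-- The acyclic orientations of the crossing graph on `P` whose only sink is the tuple with
first entry `m`. -/
def pathOrientations (m : ℕ+) (P : Finset (Fin (s + 1) → ℕ+)) :
    Finset (Finset ((Fin (s + 1) → ℕ+) × (Fin (s + 1) → ℕ+))) :=
  {E ∈ acyclicOrientations Crossing P | ∀ a ∈ P, a 0 ≠ m → ∃ b, (a, b) ∈ E}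

theorem mem_pathOrientations {m : ℕ+} {E : Finset ((Fin (s + 1) → ℕ+) × (Fin (s + 1) → ℕ+))} :
    E ∈ pathOrientations m P ↔
      IsAcyclicOrientation Crossing P E ∧ ∀ a ∈ P, a 0 ≠ m → ∃ b, (a, b) ∈ E := by
  classical
  rw [pathOrientations, Finset.mem_filter, mem_acyclicOrientations]

/-- A tuple of a system is identified by its first entry. Naming the sink by this entry gives a
notion that makes sense for all systems at once, as the summation over them requires. -/
theorem pathOrientations_eq (h : IsSystem S P) (hT : T ⊆ P) {v : Fin (s + 1) → ℕ+} (hv : v ∈ P) :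
    pathOrientations (v 0) T = pyramidOrientations Crossing v T := by
  ext E
  rw [mem_pathOrientations, mem_pyramidOrientations]
  refine and_congr_right fun _ => forall₂_congr fun a ha => ?_
  rw [ne_eq, ne_eq, (h 0).injOn.eq_iff (hT ha) hv]

/-- The number of pyramids on the systems on `S` whose maximal element has first entry `m`. -/
def pyramidNumber (m : ℕ+) (S : Fin (s + 1) → Finset ℕ+) : ℕ :=
  ∑ P ∈ systems S, (pathOrientations m P).card

/-- The tuples of `i`-element subsets of the sets `S k`, the first one containing `m`. -/
def subtuples (m : ℕ+) (S : Fin (s + 1) → Finset ℕ+) (i : ℕ) :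
    Finset (Fin (s + 1) → Finset ℕ+) :=
  Fintype.piFinset fun k => {X ∈ (S k).powersetCard i | k = 0 → m ∈ X}

theorem mem_subtuples {m : ℕ+} {i : ℕ} : S' ∈ subtuples m S i ↔
    (∀ k, S' k ⊆ S k) ∧ (∀ k, (S' k).card = i) ∧ m ∈ S' 0 := by
  simp only [subtuples, Fintype.mem_piFinset, Finset.mem_filter, Finset.mem_powersetCard]
  exact ⟨fun h => ⟨fun k => (h k).1.1, fun k => (h k).1.2, (h 0).2 rfl⟩,
    fun h k => ⟨⟨h.1 k, h.2.1 k⟩, fun hk => hk ▸ h.2.2⟩⟩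

theorem card_filter_mem_powersetCard {α : Type} [DecidableEq α] {X : Finset α} {m : α}
    (hm : m ∈ X) (i : ℕ) :
    Finset.card {Y ∈ X.powersetCard (i + 1) | m ∈ Y} = (X.card - 1).choose i := by
  rw [← Finset.card_erase_of_mem hm, ← Finset.card_powersetCard]
  refine Finset.card_nbij' (fun Y => Y.erase m) (fun Y => insert m Y) ?_ ?_ ?_ ?_
  · intro Y hY
    simp only [Finset.coe_filter, Set.mem_ofPred_eq, Finset.mem_powersetCard, Finset.mem_coe]
      at hY ⊢
    exact ⟨Finset.erase_subset_erase _ hY.1.1, by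
      rw [Finset.card_erase_of_mem hY.2, hY.1.2, Nat.add_sub_cancel]⟩
  · intro Y hY
    simp only [Finset.coe_filter, Set.mem_ofPred_eq, Finset.mem_powersetCard, Finset.mem_coe]
      at hY ⊢
    refine ⟨⟨Finset.insert_subset hm (hY.1.trans (Finset.erase_subset _ _)), ?_⟩,
      Finset.mem_insert_self _ _⟩
    rw [Finset.card_insert_of_notMem fun h => Finset.notMem_erase _ _ (hY.1 h), hY.2]
  · intro Y hY
    simp only [Finset.coe_filter, Set.mem_ofPred_eq] at hY
    exact Finset.insert_erase hY.2
  · intro Y hY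
    rw [Finset.mem_coe, Finset.mem_powersetCard] at hY
    exact Finset.erase_insert fun h => Finset.notMem_erase _ _ (hY.1 h)

/-- The first set must contain `m`, which leaves `i` choices among `n` elements; the other `s` sets
are free. -/
theorem card_subtuples {m : ℕ+} {n : ℕ} (hS : ∀ k, (S k).card = n + 1) (hm : m ∈ S 0) (i : ℕ) :
    (subtuples m S (i + 1)).card = n.choose i * (n + 1).choose (i + 1) ^ s := by
  rw [subtuples, Fintype.card_piFinset, Fin.prod_univ_succ]
  congr 1
  · simp only [forall_true_left]
    rw [card_filter_mem_powersetCard hm, hS, Nat.add_sub_cancel]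
  · simp [Fin.succ_ne_zero, hS]

-- The alternating identity is summed over all systems `P` on `S`. Only `chain S` is independent,
-- which gives the right-hand side. On the left, `T` is the chain on the complements of the entry
-- sets of `P \ T`, so it can be eliminated in favour of these sets.
open scoped Classical in
theorem sum_pyramidNumber {m : ℕ+} {n : ℕ} (hS : ∀ k, (S k).card = n + 1) (hm : m ∈ S 0) :
    (∑ i ∈ Finset.range (n + 1), ∑ S' ∈ subtuples m S (i + 1),
      (-1 : ℤ) ^ (n - i) * (pyramidNumber m S' : ℤ)) = (-1) ^ n := by
  have hroot : ∀ P ∈ systems S, ∃ v ∈ P, v 0 = m := fun P hP =>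
    (mem_systems.mp hP 0).surjOn hm
  have hleft : (∑ P ∈ systems S, ∑ T ∈ P.powerset with
      (∀ a ∈ T, a 0 ≠ m) ∧ Independent Crossing T,
        (-1 : ℤ) ^ T.card * ((pathOrientations m (P \ T)).card : ℤ)) = (-1) ^ n := by
    have hsum : ∀ P ∈ systems S, (∑ T ∈ P.powerset with
        (∀ a ∈ T, a 0 ≠ m) ∧ Independent Crossing T,
          (-1 : ℤ) ^ T.card * ((pathOrientations m (P \ T)).card : ℤ)) =
        if P = chain S then (-1) ^ n else 0 := by
      intro P hP
      obtain ⟨v, hv, rfl⟩ := hroot P hP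
      rw [mem_systems] at hP
      have hchain : Independent Crossing P ↔ P = chain S :=
        ⟨hP.eq_chain, fun h => h ▸ independent_chain S⟩
      have hT : (P.powerset.filter fun T => (∀ a ∈ T, a 0 ≠ v 0) ∧ Independent Crossing T) =
          (P.erase v).powerset.filter fun T => Independent Crossing T := by
        ext T
        simp only [Finset.mem_filter, Finset.mem_powerset, Finset.subset_erase, and_assoc]
        refine and_congr_right fun hTP => and_congr_left fun _ => ?_
        constructor
        · exact fun h hvT => h v hvT rfl
        · intro h a ha hav
          exact h ((hP 0).injOn (hTP ha) hv hav ▸ ha)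
      rw [hT, Finset.sum_congr rfl fun T _ => by
        rw [pathOrientations_eq hP Finset.sdiff_subset hv],
        sum_neg_one_pow_mul_card_pyramidOrientations (fun a b h => h.symm) hv,
        if_congr hchain rfl rfl, ← hP.card_eq 0, hS 0, add_assoc, pow_add]
      norm_num
    rw [Finset.sum_congr rfl hsum, Finset.sum_ite_eq', if_pos]
    exact mem_systems.mpr (isSystem_chain fun k l => by rw [hS, hS])
  rw [← hleft]
  simp only [pyramidNumber, Nat.cast_sum, Finset.mul_sum]
  rw [Finset.sum_sigma', Finset.sum_sigma', Finset.sum_sigma']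
  symm
  -- The root tuple stays in `P \ T`, so this set is nonempty and its size has the form `i + 1`.
  have hfwd : ∀ P ∈ systems S, ∀ T ⊆ P, (∀ a ∈ T, a 0 ≠ m) →
      (P \ T).card - 1 + 1 = (P \ T).card ∧ (P \ T).card ≤ n + 1 ∧
        m ∈ (P \ T).image fun b => b 0 := by
    intro P hP T hTP hTm
    obtain ⟨v, hv, rfl⟩ := hroot P hP
    have hvT : v ∈ P \ T := Finset.mem_sdiff.mpr ⟨hv, fun h => hTm v h rfl⟩
    have := Finset.card_pos.mpr ⟨v, hvT⟩
    refine ⟨by omega, ?_, Finset.mem_image_of_mem _ hvT⟩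
    rw [← hS 0, (mem_systems.mp hP).card_eq 0]
    exact Finset.card_le_card Finset.sdiff_subset
  have hbwd : ∀ i, ∀ S' ∈ subtuples m S (i + 1), ∀ k l, (S k \ S' k).card = (S l \ S' l).card := by
    intro i S' hS' k l
    obtain ⟨h1, h2, -⟩ := mem_subtuples.mp hS'
    rw [Finset.card_sdiff_of_subset (h1 k), Finset.card_sdiff_of_subset (h1 l), hS, hS, h2, h2]
  -- The pair (P, T) is sent to `P \ T` with its size and entry sets; the inverse adds the chain on
  -- the complementary sets.
  refine Finset.sum_bij' (fun x _ => ⟨⟨(x.1 \ x.2).card - 1, fun k => (x.1 \ x.2).image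
    fun b => b k⟩, x.1 \ x.2⟩) (fun y _ => ⟨y.2 ∪ chain fun k => S k \ y.1.2 k,
      chain fun k => S k \ y.1.2 k⟩) ?_ ?_ ?_ ?_ ?_
  · rintro ⟨P, T⟩ h
    simp only [Finset.mem_sigma, Finset.mem_filter, Finset.mem_powerset] at h
    obtain ⟨hP, hTP, hTm, hT⟩ := h
    obtain ⟨h1, h2, h3⟩ := hfwd P hP T hTP hTm
    have hsys := (mem_systems.mp hP).of_subset (Finset.sdiff_subset (s := P) (t := T))
    simp only [Finset.mem_sigma, Finset.mem_range, mem_subtuples, mem_systems]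
    refine ⟨⟨by omega, fun k => ?_, fun k => ?_, h3⟩, hsys⟩
    · rw [← (mem_systems.mp hP).image_eq k]
      exact Finset.image_subset_image Finset.sdiff_subset
    · rw [h1, hsys.card_eq k]
  · rintro ⟨⟨i, S'⟩, P'⟩ h
    simp only [Finset.mem_sigma, Finset.mem_range] at h
    obtain ⟨⟨hi, hS'⟩, hP'⟩ := h
    have hch := isSystem_chain (hbwd i S' hS')
    rw [mem_systems] at hP'
    simp only [Finset.mem_sigma, Finset.mem_filter, Finset.mem_powerset, mem_systems]
    refine ⟨hP'.union (mem_subtuples.mp hS').1 hch, Finset.subset_union_right, fun a ha ham => ?_,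
      independent_chain _⟩
    exact (Finset.mem_sdiff.mp ((hch 0).mapsTo ha)).2
      (show a 0 ∈ S' 0 from ham ▸ (mem_subtuples.mp hS').2.2)
  · rintro ⟨P, T⟩ h
    simp only [Finset.mem_sigma, Finset.mem_filter, Finset.mem_powerset] at h
    obtain ⟨hP, hTP, hTm, hT⟩ := h
    have e := ((mem_systems.mp hP).sdiff hTP).eq_chain hT
    simp only [← e, Finset.sdiff_union_of_subset hTP]
  · rintro ⟨⟨i, S'⟩, P'⟩ h
    simp only [Finset.mem_sigma, Finset.mem_range] at h
    obtain ⟨⟨hi, hS'⟩, hP'⟩ := h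
    have hch := isSystem_chain (hbwd i S' hS')
    rw [mem_systems] at hP'
    have e : (P' ∪ chain fun k => S k \ S' k) \ (chain fun k => S k \ S' k) = P' :=
      Finset.union_sdiff_cancel_right (hP'.disjoint hch)
    have e1 : P'.card - 1 = i := by
      rw [← hP'.card_eq 0, (mem_subtuples.mp hS').2.1, Nat.add_sub_cancel]
    have e2 : (fun k => P'.image fun b => b k) = S' := funext hP'.image_eq
    dsimp only
    rw [e, e1, e2]
  · rintro ⟨P, T⟩ h
    simp only [Finset.mem_sigma, Finset.mem_filter, Finset.mem_powerset] at h
    obtain ⟨hP, hTP, hTm, hT⟩ := h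
    obtain ⟨h1, h2, h3⟩ := hfwd P hP T hTP hTm
    have h4 := Finset.card_sdiff_add_card_eq_card hTP
    rw [← (mem_systems.mp hP).card_eq 0, hS] at h4
    dsimp only
    rw [show n - ((P \ T).card - 1) = T.card by omega]

/-- Both sides satisfy the same recursion, in which the top term i = n has coefficient 1. The sets
`S` are arbitrary because the recursion descends to arbitrary subsets of them. -/
theorem rNumber_eq_pyramidNumber {m : ℕ+} (n : ℕ) (S : Fin (s + 1) → Finset ℕ+)
    (hS : ∀ k, (S k).card = n + 1) (hm : m ∈ S 0) :
    rNumber (RPartition (s + 1)) (n + 1) = (pyramidNumber m S : ℚ) := by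
  induction n using Nat.strong_induction_on generalizing S with
  | _ n ih =>
    have h1 := rNumber_linear_recursion _ s (numMinimal_rPartition s) n
    rw [Finset.Nat.sum_antidiagonal_eq_sum_range_succ_mk] at h1
    have h2 := congrArg (Int.cast : ℤ → ℚ) (sum_pyramidNumber hS hm)
    push_cast at h2
    rw [← h1, Finset.sum_range_succ, Finset.sum_range_succ] at h2
    have hlt : ∀ i ∈ Finset.range n, (∑ S' ∈ subtuples m S (i + 1),
        (-1 : ℚ) ^ (n - i) * (pyramidNumber m S' : ℚ)) = (n.choose i : ℚ) *
          ((n + 1).choose (i + 1) : ℚ) ^ s * (-1) ^ (n - i) *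
            rNumber (RPartition (s + 1)) (i + 1) := by
      intro i hi
      rw [Finset.sum_congr rfl fun S' hS' => by
        rw [← ih i (Finset.mem_range.mp hi) S' (mem_subtuples.mp hS').2.1
          (mem_subtuples.mp hS').2.2], Finset.sum_const, card_subtuples hS hm, nsmul_eq_mul]
      push_cast
      ring
    rw [Finset.sum_congr rfl hlt, add_right_inj] at h2
    have hself : subtuples m S (n + 1) = {S} := by
      ext S'
      rw [mem_subtuples, Finset.mem_singleton]
      constructor
      · exact fun h => funext fun k => Finset.eq_of_subset_of_card_le (h.1 k)
          (by rw [hS, h.2.1])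
      · rintro rfl
        exact ⟨fun _ => subset_rfl, hS, hm⟩
    rw [hself] at h2
    simpa using h2.symm

end System

/-! ### Heaps with distinct labels as acyclic orientations -/

section HeapOrientation

variable {B : Type} {R : B → B → Prop} {P : Finset B} {E : Finset (B × B)}

theorem IsAcyclicOrientation.rank_le {f : B → ℕ} (hf : ∀ a b, (a, b) ∈ E → f a < f b) {a b : B}
    (h : Relation.ReflTransGen (fun x y => (x, y) ∈ E) a b) : f a ≤ f b ∧ (a ≠ b → f a < f b) := by
  induction h with
  | refl => exact ⟨le_rfl, fun h => absurd rfl h⟩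
  | tail _ hbc ih => exact ⟨(ih.1.trans_lt (hf _ _ hbc)).le, fun _ => ih.1.trans_lt (hf _ _ hbc)⟩

/-- The heap of an acyclic orientation: `a ≤ b` if there is an oriented path from `a` to `b`. -/
def IsAcyclicOrientation.heap (h : IsAcyclicOrientation R P E) :
    Heap B R where
  carrier := {a // a ∈ P}
  order :=
    { le := fun a b => Relation.ReflTransGen (fun x y => (x, y) ∈ E) a.1 b.1
      le_refl := fun _ => .refl
      le_trans := fun _ _ _ => .trans
      le_antisymm := by
        intro a b hab hba
        obtain ⟨f, hf⟩ := h.rank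
        by_contra hne
        have hne' : a.1 ≠ b.1 := fun e => hne (Subtype.ext e)
        exact lt_asymm ((rank_le hf hab).2 hne') ((rank_le hf hba).2 hne'.symm) }
  label := Subtype.val
  comparable := by
    rintro ⟨a, ha⟩ ⟨b, hb⟩ hab
    by_cases hne : a = b
    · subst hne
      exact .inl .refl
    · exact (h.total a ha b hb hne hab).imp .single .single
  related_of_covBy := by
    rintro ⟨a, ha⟩ ⟨b, hb⟩ ⟨⟨hab, hba⟩, hcov⟩
    obtain ⟨f, hf⟩ := h.rank
    -- The first edge of an oriented path from `a` to `b` ends at `b`, since otherwise its end would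
    -- lie strictly between them.
    rcases Relation.ReflTransGen.cases_head hab with heq | ⟨c, hac, hcb⟩
    · have heq : a = b := heq
      subst heq
      exact absurd .refl hba
    · have hcb' : c = b := by
        by_contra hne
        refine hcov (c := ⟨c, h.right_mem hac⟩) ⟨.single hac, fun hca => ?_⟩
          ⟨hcb, fun hbc => ?_⟩
        · exact absurd (hf _ _ hac) (not_lt.mpr (rank_le hf hca).1)
        · exact absurd ((rank_le hf hcb).2 hne) (not_lt.mpr (rank_le hf hbc).1)
      exact h.rel _ _ (hcb' ▸ hac)

/-- The orientation can be recovered from the order it generates: a related pair cannot be oriented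
against that order. -/
theorem IsAcyclicOrientation.mem_iff (h : IsAcyclicOrientation R P E) {a b : B} :
    (a, b) ∈ E ↔ a ∈ P ∧ b ∈ P ∧ a ≠ b ∧ R a b ∧
      Relation.ReflTransGen (fun x y => (x, y) ∈ E) a b := by
  obtain ⟨f, hf⟩ := h.rank
  constructor
  · intro he
    exact ⟨h.left_mem he, h.right_mem he, fun e => absurd (hf _ _ he) (by simp [e]), h.rel _ _ he,
      .single he⟩
  · rintro ⟨ha, hb, hne, hab, hle⟩
    refine (h.total a ha b hb hne hab).resolve_right fun he => ?_
    exact absurd (hf _ _ he) (not_lt.mpr (rank_le hf hle).1)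

/-- The elements of these heaps are their own labels, so a label-preserving isomorphism acts as the
identity on them. -/
theorem IsAcyclicOrientation.eq_of_heap_equiv {P' : Finset B}
    {E' : Finset (B × B)} (h : IsAcyclicOrientation R P E) (h' : IsAcyclicOrientation R P' E')
    (e : (h.heap).carrier ≃o (h'.heap).carrier)
    (he : ∀ x, (h'.heap).label (e x) = (h.heap).label x) : P = P' ∧ E = E' := by
  have he' : ∀ (x : {a // a ∈ P}) (y : {a // a ∈ P'}), e x = y → y.1 = x.1 := by
    rintro x y rfl
    exact he x
  have hP : P = P' := by
    ext a
    constructor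
    · intro ha
      obtain ⟨y, hy⟩ : ∃ y : {a // a ∈ P'}, e (⟨a, ha⟩ : {a // a ∈ P}) = y := ⟨_, rfl⟩
      have h1 : y.1 = a := he' _ _ hy
      exact h1 ▸ y.2
    · intro ha
      obtain ⟨x, hx⟩ : ∃ x : {a // a ∈ P}, e x = (⟨a, ha⟩ : {a // a ∈ P'}) := e.surjective _
      have h1 : a = x.1 := he' _ _ hx
      exact h1 ▸ x.2
  refine ⟨hP, ?_⟩
  ext ⟨a, b⟩
  rw [h.mem_iff, h'.mem_iff, ← hP]
  refine and_congr_right fun ha => and_congr_right fun hb => and_congr_right fun _ =>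
    and_congr_right fun _ => ?_
  have ea : e (⟨a, ha⟩ : {a // a ∈ P}) = (⟨a, hP ▸ ha⟩ : {a // a ∈ P'}) :=
    Subtype.ext (he' _ _ rfl)
  have eb : e (⟨b, hb⟩ : {a // a ∈ P}) = (⟨b, hP ▸ hb⟩ : {a // a ∈ P'}) :=
    Subtype.ext (he' _ _ rfl)
  have h1 := e.le_iff_le (x := (⟨a, ha⟩ : {a // a ∈ P})) (y := (⟨b, hb⟩ : {a // a ∈ P}))
  rw [ea, eb] at h1
  exact h1.symm

theorem Heap.exists_covBy (H : Heap B R) {x y : H.carrier} (h : x < y) : ∃ z, x ⋖ z ∧ z ≤ y := by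
  obtain ⟨z, hz⟩ := (Set.toFinite {z | x < z ∧ z ≤ y}).exists_minimal ⟨y, h, le_rfl⟩
  refine ⟨z, ⟨hz.prop.1, fun w hxw hwz => ?_⟩, hz.prop.2⟩
  exact hwz.not_ge (hz.le_of_le ⟨hxw, hwz.le.trans hz.prop.2⟩ hwz.le)

/-- The set of labels of a heap. -/
def Heap.labels (H : Heap B R) : Finset B := (Set.finite_range H.label).toFinset

theorem Heap.mem_labels {H : Heap B R} {a : B} : a ∈ H.labels ↔ ∃ x, H.label x = a := by
  rw [Heap.labels, Set.Finite.mem_toFinset, Set.mem_range]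

open scoped Classical in
/-- The pairs of related labels of a heap, oriented upwards. -/
def Heap.edges (H : Heap B R) : Finset (B × B) :=
  {e ∈ H.labels ×ˢ H.labels | ∃ x y, H.label x = e.1 ∧ H.label y = e.2 ∧ x < y ∧ R e.1 e.2}

theorem Heap.mem_edges {H : Heap B R} {a b : B} : (a, b) ∈ H.edges ↔
    ∃ x y, H.label x = a ∧ H.label y = b ∧ x < y ∧ R a b := by
  classical
  rw [Heap.edges, Finset.mem_filter, Finset.mem_product, Heap.mem_labels, Heap.mem_labels]
  exact ⟨fun h => h.2, fun ⟨x, y, hx, hy, h⟩ => ⟨⟨⟨x, hx⟩, y, hy⟩, x, y, hx, hy, h⟩⟩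

theorem Heap.isAcyclicOrientation (H : Heap B R) (hR : ∀ a b, R a b → R b a)
    (hinj : Function.Injective H.label) : IsAcyclicOrientation R H.labels H.edges where
  subset := by
    classical
    exact Finset.filter_subset _ _
  rel a b h := by
    obtain ⟨x, y, -, -, -, h⟩ := Heap.mem_edges.mp h
    exact h
  total := by
    intro a ha b hb hne hab
    obtain ⟨x, rfl⟩ := Heap.mem_labels.mp ha
    obtain ⟨y, rfl⟩ := Heap.mem_labels.mp hb
    have hxy : x ≠ y := fun e => hne (e ▸ rfl)
    refine (H.comparable x y hab).imp (fun h => ?_) fun h => ?_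
    · exact Heap.mem_edges.mpr ⟨x, y, rfl, rfl, lt_of_le_of_ne h hxy, hab⟩
    · exact Heap.mem_edges.mpr ⟨y, x, rfl, rfl, lt_of_le_of_ne h hxy.symm, hR _ _ hab⟩
  rank := by
    -- The rank is the number of elements below; distinct labels make the element `x` unique.
    refine ⟨fun a => Set.ncard {z | ∃ x, H.label x = a ∧ z < x}, fun a b h => ?_⟩
    obtain ⟨x, y, rfl, rfl, hxy, -⟩ := Heap.mem_edges.mp h
    refine Set.ncard_lt_ncard ?_ (Set.toFinite _)
    refine (Set.ssubset_iff_of_subset ?_).mpr ⟨x, ⟨y, rfl, hxy⟩, ?_⟩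
    · rintro z ⟨x', hx', hz⟩
      exact ⟨y, rfl, (hinj hx' ▸ hz).trans hxy⟩
    · rintro ⟨x', hx', hz⟩
      exact lt_irrefl _ (hinj hx' ▸ hz)

/-- A finite order is generated by its covering relations, and in a heap each of these is an edge.
The induction is on the number of elements above `x`. -/
theorem Heap.reflTransGen_edges_iff (H : Heap B R) (hinj : Function.Injective H.label)
    (x y : H.carrier) :
    Relation.ReflTransGen (fun a b => (a, b) ∈ H.edges) (H.label x) (H.label y) ↔ x ≤ y := by
  constructor
  · intro h
    generalize hb : H.label y = b at h
    induction h generalizing y with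
    | refl => exact (hinj hb).ge
    | tail _ hbc ih =>
      obtain ⟨x', y', hx', hy', hlt, -⟩ := Heap.mem_edges.mp hbc
      exact (ih x' hx').trans (hlt.le.trans (hinj (hy'.trans hb.symm)).le)
  · intro h
    induction hk : Set.ncard {z | x < z} using Nat.strong_induction_on generalizing x with
    | _ k ih =>
      rcases h.eq_or_lt with rfl | hlt
      · exact .refl
      · obtain ⟨z, hxz, hzy⟩ := H.exists_covBy hlt
        refine .head (Heap.mem_edges.mpr ⟨x, z, rfl, rfl, hxz.lt, H.related_of_covBy x z hxz⟩)
          (ih _ ?_ z hzy rfl)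
        rw [← hk]
        refine Set.ncard_lt_ncard ?_ (Set.toFinite _)
        exact (Set.ssubset_iff_of_subset fun w hw => hxz.lt.trans hw).mpr
          ⟨z, hxz.lt, lt_irrefl z⟩

/-- A heap with distinct labels is isomorphic to the heap of its orientation. -/
theorem Heap.heap_edges_equiv (H : Heap B R) (hR : ∀ a b, R a b → R b a)
    (hinj : Function.Injective H.label) :
    (H.isAcyclicOrientation hR hinj).heap ≈ H := by
  let e : H.carrier ≃ {a // a ∈ H.labels} := Equiv.ofBijective
    (fun x => ⟨H.label x, Heap.mem_labels.mpr ⟨x, rfl⟩⟩)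
    ⟨fun x y h => hinj (congrArg Subtype.val h), fun ⟨a, ha⟩ => by
      obtain ⟨x, hx⟩ := Heap.mem_labels.mp ha
      exact ⟨x, Subtype.ext hx⟩⟩
  let f : H.carrier ≃o ((H.isAcyclicOrientation hR hinj).heap).carrier :=
    { toEquiv := e
      map_rel_iff' := fun {x y} => H.reflTransGen_edges_iff hinj x y }
  exact Setoid.symm ⟨f, fun x => rfl⟩

end HeapOrientation

/-! ### Systems of paths of permutations -/

section PathSystem

variable {n s : ℕ}

/-- The set `[n]` of positive integers, repeated for each entry of a path. -/
def intervalTuple (s n : ℕ) : Fin (s + 1) → Finset ℕ+ :=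
  fun _ => Finset.univ.image fun i : Fin n => i.val.succPNat

theorem succPNat_val_injective : Function.Injective fun i : Fin n => i.val.succPNat :=
  fun _ _ h => Fin.ext (Nat.succPNat_injective h)

theorem card_intervalTuple (k : Fin (s + 1)) : (intervalTuple s n k).card = n := by
  rw [intervalTuple, Finset.card_image_of_injective _ succPNat_val_injective, Finset.card_univ,
    Fintype.card_fin]

theorem mem_intervalTuple {k : Fin (s + 1)} {x : ℕ+} :
    x ∈ intervalTuple s n k ↔ ∃ i : Fin n, i.val.succPNat = x := by
  simp [intervalTuple]

theorem pathVertex_bijective {r : ℕ} (σ : Fin (r - 1) → Equiv.Perm (Fin n)) (k : ℕ) :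
    Function.Bijective fun m => pathVertex σ m k := by
  induction k with
  | zero => exact Function.bijective_id
  | succ k ih =>
    by_cases h : k < r - 1
    · simp only [pathVertex, dif_pos h]
      exact (σ ⟨k, h⟩).bijective.comp ih
    · simp only [pathVertex, dif_neg h]
      exact ih

theorem isSystem_of_coe_eq_range_path {P : Finset (Fin (s + 1) → ℕ+)}
    (σ : Fin (s + 1 - 1) → Equiv.Perm (Fin n))
    (hP : (P : Set (Fin (s + 1) → ℕ+)) = Set.range (path σ)) :
    IsSystem (intervalTuple s n) P := by
  intro k
  rw [hP]
  refine ⟨?_, ?_, ?_⟩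
  · rintro _ ⟨m, rfl⟩
    exact mem_intervalTuple.mpr ⟨pathVertex σ m k, rfl⟩
  · rintro _ ⟨m, rfl⟩ _ ⟨m', rfl⟩ h
    rw [(pathVertex_bijective σ k).injective (succPNat_val_injective h)]
  · intro x hx
    obtain ⟨i, rfl⟩ := mem_intervalTuple.mp hx
    obtain ⟨m, rfl⟩ := (pathVertex_bijective σ k).surjective i
    exact ⟨path σ m, ⟨m, rfl⟩, rfl⟩

/-- The products of the steps g_(i+1) g_i⁻¹ telescope. -/
theorem pathVertex_eq (g : ℕ → Equiv.Perm (Fin n)) (hg : g 0 = 1) (m : Fin n) {k : ℕ}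
    (hk : k ≤ s) :
    pathVertex (r := s + 1) (fun i => (g i).symm.trans (g (i + 1))) m k = g k m := by
  induction k with
  | zero => simp [pathVertex, hg]
  | succ k ih =>
    rw [pathVertex, dif_pos (show k < s + 1 - 1 by omega), ih (by omega)]
    simp

/-- With the tuples indexed by their first entry, the `k`-th entries form a permutation `g k` with
`g 0 = 1`, and the required steps are the quotients of consecutive `g k`. -/
theorem IsSystem.exists_coe_eq_range_path {P : Finset (Fin (s + 1) → ℕ+)}
    (h : IsSystem (intervalTuple s n) P) :
    ∃ σ : Fin (s + 1 - 1) → Equiv.Perm (Fin n),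
      (P : Set (Fin (s + 1) → ℕ+)) = Set.range (path σ) := by
  have hc : ∀ i : Fin n, ∃ b, b ∈ P ∧ b 0 = i.val.succPNat := fun i =>
    (h 0).surjOn (mem_intervalTuple.mpr ⟨i, rfl⟩)
  choose c hcP hc0 using hc
  have hj : ∀ (k : Fin (s + 1)) (i : Fin n), ∃ j : Fin n, j.val.succPNat = c i k := fun k i =>
    mem_intervalTuple.mp ((h k).mapsTo (hcP i))
  choose j hj using hj
  have hjinj : ∀ k, Function.Injective (j k) := by
    intro k i i' hii'
    have hck : c i k = c i' k := by rw [← hj, ← hj, hii']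
    have hcc : c i = c i' := (h k).injOn (hcP i) (hcP i') hck
    refine succPNat_val_injective ?_
    dsimp only
    rw [← hc0, ← hc0, hcc]
  -- The value 1 beyond `k = s` is never used.
  let g : ℕ → Equiv.Perm (Fin n) := fun k => if hk : k < s + 1 then
    Equiv.ofBijective (j ⟨k, hk⟩) (Finite.injective_iff_bijective.mp (hjinj _)) else 1
  have hg0 : g 0 = 1 := by
    ext i
    simp only [g, dif_pos s.succ_pos, Equiv.ofBijective_apply, Equiv.Perm.coe_one, id_eq]
    refine congrArg _ (succPNat_val_injective ?_)
    exact (hj _ i).trans (hc0 i)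
  have hpath : ∀ m, path (r := s + 1) (fun i => (g i).symm.trans (g (i + 1))) m = c m := by
    intro m
    funext k
    rw [path, pathVertex_eq g hg0 m (Nat.lt_succ_iff.mp k.2), ← hj k m]
    simp only [g, dif_pos k.2, Equiv.ofBijective_apply]
  refine ⟨fun i => (g i).symm.trans (g (i + 1)), Set.ext fun b => ⟨fun hb => ?_, ?_⟩⟩
  · obtain ⟨i, hi⟩ := mem_intervalTuple.mp ((h 0).mapsTo hb)
    refine ⟨i, (hpath i).trans ((h 0).injOn (hcP i) hb ?_)⟩
    exact (hc0 i).trans hi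
  · rintro ⟨m, rfl⟩
    rw [hpath]
    exact hcP m

/-! ### Counting the pyramids -/

/-- An element with an outgoing edge is not maximal, so only the path from 1 can be; it is maximal
because a nonempty finite poset has a maximal element. -/
theorem isPathPyramid_heap (hn : 1 ≤ n) {P : Finset (Fin (s + 1) → ℕ+)}
    {E : Finset ((Fin (s + 1) → ℕ+) × (Fin (s + 1) → ℕ+))} (hP : IsSystem (intervalTuple s n) P)
    (hE : IsAcyclicOrientation Crossing P E) (hE' : ∀ a ∈ P, a 0 ≠ 1 → ∃ b, (a, b) ∈ E) :
    IsPathPyramid (s + 1) n hE.heap := by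
  obtain ⟨σ, hσ⟩ := hP.exists_coe_eq_range_path
  have hmem : ∀ m, path σ m ∈ P := fun m => by
    rw [← Finset.mem_coe, hσ]
    exact ⟨m, rfl⟩
  obtain ⟨f, hf⟩ := hE.rank
  let v : hE.heap.carrier := (⟨path σ ⟨0, hn⟩, hmem _⟩ : {a // a ∈ P})
  have hmax : ∀ x : hE.heap.carrier, IsMax x → x = v := by
    rintro ⟨a, ha⟩ hx
    refine Subtype.ext ?_
    by_contra hne
    obtain ⟨b, hb⟩ := hE' a ha fun h0 => hne ((hP 0).injOn ha (hmem _) h0)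
    have hba := @hx (⟨b, hE.right_mem hb⟩ : {a // a ∈ P}) (Relation.ReflTransGen.single hb)
    exact absurd (hf _ _ hb) (not_lt.mpr (IsAcyclicOrientation.rank_le hf hba).1)
  have hv : IsMax v := by
    have : Nonempty hE.heap.carrier := ⟨v⟩
    obtain ⟨x, hx⟩ := Set.finite_univ.exists_maximal (Set.univ_nonempty (α := hE.heap.carrier))
    have hx' : IsMax x := fun y hy => hx.le_of_ge (Set.mem_univ y) hy
    exact hmax x hx' ▸ hx'
  refine ⟨⟨v, hv, hmax⟩, σ, Subtype.val_injective, ?_, v, ⟨0, hn⟩, hv, rfl, rfl⟩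
  rw [← hσ]
  exact Subtype.range_val

theorem Heap.mem_pathOrientations_of_isPathPyramid {H : Heap (Fin (s + 1) → ℕ+) Crossing}
    (hH : IsPathPyramid (s + 1) n H) :
    IsSystem (intervalTuple s n) H.labels ∧ H.edges ∈ pathOrientations 1 H.labels := by
  obtain ⟨⟨v, hv, huniq⟩, σ, hinj, hrange, x, m, hx, hm, hxm⟩ := hH
  refine ⟨isSystem_of_coe_eq_range_path σ ?_, mem_pathOrientations.mpr
    ⟨H.isAcyclicOrientation (fun _ _ => Crossing.symm) hinj, ?_⟩⟩
  · rw [← hrange, Heap.labels, Set.Finite.coe_toFinset]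
  · intro a ha ha1
    obtain ⟨y, rfl⟩ := Heap.mem_labels.mp ha
    have hy : ¬IsMax y := by
      intro hy
      apply ha1
      rw [huniq y hy, ← huniq x hx, hxm]
      simp [path, pathVertex, hm]
      rfl
    obtain ⟨z, hz⟩ := not_isMax_iff.mp hy
    -- A non-maximal element is covered by another one, and this covering relation is an outgoing
    -- edge.
    obtain ⟨w, hw, -⟩ := H.exists_covBy hz
    exact ⟨H.label w, Heap.mem_edges.mpr ⟨y, w, rfl, rfl, hw.lt, H.related_of_covBy _ _ hw⟩⟩

/-- Pyramids of paths correspond to acyclic orientations of crossing graphs. -/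
theorem finite_and_card_pathPyramid (s : ℕ) (hn : 1 ≤ n) :
    Finite (PathPyramid (s + 1) n) ∧
      Nat.card (PathPyramid (s + 1) n) = pyramidNumber 1 (intervalTuple s n) := by
  let D := (systems (intervalTuple s n)).sigma fun P => pathOrientations 1 P
  have hD : ∀ x : {x // x ∈ D}, IsSystem (intervalTuple s n) x.1.1 ∧
      IsAcyclicOrientation Crossing x.1.1 x.1.2 ∧
        ∀ a ∈ x.1.1, a 0 ≠ 1 → ∃ b, (a, b) ∈ x.1.2 := fun x => by
    have := Finset.mem_sigma.mp x.2
    exact ⟨mem_systems.mp this.1, mem_pathOrientations.mp this.2⟩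
  let F : {x // x ∈ D} → PathPyramid (s + 1) n := fun x =>
    ⟨Quotient.mk _ (hD x).2.1.heap, _, isPathPyramid_heap hn (hD x).1 (hD x).2.1 (hD x).2.2, rfl⟩
  have hF : Function.Bijective F := by
    constructor
    · rintro x y hxy
      obtain ⟨e, he⟩ := Quotient.exact (congrArg Subtype.val hxy)
      obtain ⟨h1, h2⟩ := (hD x).2.1.eq_of_heap_equiv (hD y).2.1 e he
      exact Subtype.ext (Sigma.ext h1 (heq_of_eq h2))
    · rintro ⟨_, H, hH, rfl⟩
      obtain ⟨h1, h2⟩ := H.mem_pathOrientations_of_isPathPyramid hH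
      obtain ⟨-, σ, hinj, -⟩ := hH
      exact ⟨⟨⟨H.labels, H.edges⟩, Finset.mem_sigma.mpr ⟨mem_systems.mpr h1, h2⟩⟩,
        Subtype.ext (Quotient.sound (H.heap_edges_equiv (fun _ _ => Crossing.symm) hinj))⟩
  refine ⟨Finite.of_surjective F hF.surjective, ?_⟩
  rw [← Nat.card_eq_of_bijective F hF, Nat.card_eq_fintype_card, Fintype.card_coe,
    Finset.card_sigma]
  rfl

theorem finite_pathPyramid_and_rNumber_eq (s : ℕ) (hn : 1 ≤ n) :
    Finite (PathPyramid (s + 1) n) ∧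
      rNumber (RPartition (s + 1)) n = (Nat.card (PathPyramid (s + 1) n) : ℚ) := by
  obtain ⟨h1, h2⟩ := finite_and_card_pathPyramid s hn
  refine ⟨h1, ?_⟩
  rw [h2]
  obtain ⟨n, rfl⟩ := Nat.exists_eq_add_of_le' hn
  exact rNumber_eq_pyramidNumber n _ card_intervalTuple
    (mem_intervalTuple.mpr ⟨0, rfl⟩)

end PathSystem

/-! ### Trees on arbitrary sets of coordinates -/

section Tree

/-- A point of `A` precedes `p` on the line of first coordinate `p.1`. -/
def HasPrevSnd (A : Finset (ℕ × ℕ)) (p : ℕ × ℕ) : Prop := ∃ q ∈ A, q.2 < p.2 ∧ q.1 = p.1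

/-- A point of `A` precedes `p` on the line of second coordinate `p.2`. -/
def HasPrevFst (A : Finset (ℕ × ℕ)) (p : ℕ × ℕ) : Prop := ∃ q ∈ A, q.1 < p.1 ∧ q.2 = p.2

/-- A point of `A` follows `p` on the line of first coordinate `p.1`. -/
def HasNextSnd (A : Finset (ℕ × ℕ)) (p : ℕ × ℕ) : Prop := ∃ q ∈ A, p.2 < q.2 ∧ q.1 = p.1

/-- A point of `A` follows `p` on the line of second coordinate `p.2`. -/
def HasNextFst (A : Finset (ℕ × ℕ)) (p : ℕ × ℕ) : Prop := ∃ q ∈ A, p.1 < q.1 ∧ q.2 = p.2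

/-- A complete non-ambiguous tree with root `r`, without the condition that the coordinates of its
points form intervals. -/
structure IsTree (r : ℕ × ℕ) (A : Finset (ℕ × ℕ)) : Prop where
  root_mem : r ∈ A
  root_le : ∀ p ∈ A, r.1 ≤ p.1 ∧ r.2 ≤ p.2
  xor_prev : ∀ p ∈ A, p ≠ r → Xor (HasPrevSnd A p) (HasPrevFst A p)
  next_iff : ∀ p ∈ A, HasNextSnd A p ↔ HasNextFst A p

theorem mem_image_swap {A : Finset (ℕ × ℕ)} {p : ℕ × ℕ} :
    p ∈ A.image Prod.swap ↔ p.swap ∈ A := by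
  rw [Finset.mem_image]
  constructor
  · rintro ⟨q, hq, rfl⟩
    simpa using hq
  · exact fun h => ⟨_, h, Prod.swap_swap p⟩

theorem image_swap_image_swap (A : Finset (ℕ × ℕ)) :
    (A.image Prod.swap).image Prod.swap = A := by
  ext p
  rw [mem_image_swap, mem_image_swap, Prod.swap_swap]

theorem image_fst_image_swap (A : Finset (ℕ × ℕ)) :
    (A.image Prod.swap).image Prod.fst = A.image Prod.snd := by
  rw [Finset.image_image]; rfl

theorem image_snd_image_swap (A : Finset (ℕ × ℕ)) :
    (A.image Prod.swap).image Prod.snd = A.image Prod.fst := by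
  rw [Finset.image_image]; rfl

theorem exists_mem_image_swap {A : Finset (ℕ × ℕ)} {C : ℕ × ℕ → Prop} :
    (∃ q ∈ A.image Prod.swap, C q) ↔ ∃ q ∈ A, C q.swap := by
  constructor
  · rintro ⟨q, hq, h⟩
    exact ⟨q.swap, mem_image_swap.mp hq, by rwa [Prod.swap_swap]⟩
  · rintro ⟨q, hq, h⟩
    exact ⟨q.swap, mem_image_swap.mpr (by rwa [Prod.swap_swap]), h⟩

variable {A A₁ A₂ : Finset (ℕ × ℕ)} {r : ℕ × ℕ}

/-- By this symmetry it suffices to study the subtree that starts in the column of the root. -/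
theorem IsTree.swap (h : IsTree r A) : IsTree r.swap (A.image Prod.swap) where
  root_mem := mem_image_swap.mpr (by simpa using h.root_mem)
  root_le p hp := (h.root_le _ (mem_image_swap.mp hp)).symm
  xor_prev p hp hpr := by
    have hne : p.swap ≠ r := fun e => hpr (by rw [← e, Prod.swap_swap])
    have := (h.xor_prev _ (mem_image_swap.mp hp) hne)
    rw [xor_comm] at this
    rwa [HasPrevSnd, HasPrevFst, exists_mem_image_swap, exists_mem_image_swap]
  next_iff p hp := by
    rw [HasNextSnd, HasNextFst, exists_mem_image_swap, exists_mem_image_swap]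
    exact (h.next_iff _ (mem_image_swap.mp hp)).symm

theorem isTree_singleton (r : ℕ × ℕ) : IsTree r {r} where
  root_mem := Finset.mem_singleton_self r
  root_le p hp := by rw [Finset.mem_singleton.mp hp]; exact ⟨le_rfl, le_rfl⟩
  xor_prev p hp hpr := absurd (Finset.mem_singleton.mp hp) hpr
  next_iff p hp := by simp [HasNextSnd, HasNextFst, Finset.mem_singleton.mp hp]

/-- The root of a tree with at least two points has two children. -/
theorem IsTree.hasNext_root (h : IsTree r A) (hA : A ≠ {r}) :
    HasNextSnd A r ∧ HasNextFst A r := by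
  suffices H : HasNextSnd A r ∨ HasNextFst A r by
    rcases H with H | H
    · exact ⟨H, (h.next_iff r h.root_mem).mp H⟩
    · exact ⟨(h.next_iff r h.root_mem).mpr H, H⟩
  have hne : (A.erase r).Nonempty := by
    rw [Finset.nonempty_iff_ne_empty, ne_eq, Finset.erase_eq_empty_iff]
    rintro (h0 | h0)
    · exact absurd h.root_mem (by simp [h0])
    · exact hA h0
  -- The predecessor of `p` has a smaller coordinate sum, so it must be the root.
  obtain ⟨p, hp, hmin⟩ := (A.erase r).exists_min_image (fun p => p.1 + p.2) hne
  obtain ⟨hpr, hpA⟩ := Finset.mem_erase.mp hp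
  have hroot : ∀ q ∈ A, q.1 + q.2 < p.1 + p.2 → q = r := by
    intro q hq hlt
    by_contra hqr
    exact absurd (hmin q (Finset.mem_erase.mpr ⟨hqr, hq⟩)) (not_le.mpr hlt)
  rcases (h.xor_prev p hpA hpr).or with ⟨q, hq, h1, h2⟩ | ⟨q, hq, h1, h2⟩
  · obtain rfl := hroot q hq (by omega)
    exact .inl ⟨p, hpA, h1, h2.symm⟩
  · obtain rfl := hroot q hq (by omega)
    exact .inr ⟨p, hpA, h1, h2.symm⟩

/-! ### Removing the root -/

/-- A two-colouring of the lines meeting `A`, for which the two lines through each point other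
than the root have the same colour and the lines through the root have different ones. -/
structure IsColouring (r : ℕ × ℕ) (A : Finset (ℕ × ℕ)) (f g : ℕ → Prop) : Prop where
  fst_root : f r.1
  snd_root : ¬g r.2
  iff : ∀ p ∈ A, p ≠ r → (f p.1 ↔ g p.2)

theorem IsColouring.swap {f g : ℕ → Prop} (h : IsColouring r A f g) :
    IsColouring r.swap (A.image Prod.swap) (fun y => ¬g y) (fun x => ¬f x) where
  fst_root := h.snd_root
  snd_root := not_not.mpr h.fst_root
  iff p hp hpr := by
    have hne : p.swap ≠ r := fun e => hpr (by rw [← e, Prod.swap_swap])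
    exact not_congr (h.iff _ (mem_image_swap.mp hp) hne).symm

/-- The first coordinates of the points on the side of the root's line of first coordinate
`r.1`. -/
inductive IsLeft (r : ℕ × ℕ) (A : Finset (ℕ × ℕ)) : ℕ → Prop
  | root : IsLeft r A r.1
  | step {x x' y : ℕ} (h' : (x', y) ∈ A) (hfirst' : ∀ q ∈ A, q.2 = y → x' ≤ q.1)
      (h : (x, y) ∈ A) (hfirst : ∀ q ∈ A, q.1 = x → y ≤ q.2) (hy : y ≠ r.2)
      (hleft : IsLeft r A x') : IsLeft r A x

/-- A row takes the colour of the column of its first point, except that the root's row is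
uncoloured. A column other than the root's takes the colour of the row of its first point; `IsLeft`
combines these two rules. Since exactly one predecessor exists, a point other than the root is first
in its row or first in its column, and one of the rules applies to it. -/
theorem IsTree.exists_isColouring (h : IsTree r A) : ∃ f g, IsColouring r A f g := by
  refine ⟨IsLeft r A, fun y => y ≠ r.2 ∧ ∃ x, (x, y) ∈ A ∧ (∀ q ∈ A, q.2 = y → x ≤ q.1) ∧
    IsLeft r A x, .root, fun hy => hy.1 rfl, ?_⟩
  rintro ⟨x, y⟩ hp hpr
  dsimp only
  rcases h.xor_prev _ hp hpr with ⟨⟨q, hq, hqy, -⟩, hno⟩ | ⟨⟨q, hq, hqx, hqy⟩, hno⟩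
  · have hfirst : ∀ q ∈ A, q.2 = y → x ≤ q.1 := fun q hq hqy =>
      not_lt.mp fun hlt => hno ⟨q, hq, hlt, hqy⟩
    constructor
    · exact fun hx => ⟨((h.root_le q hq).2.trans_lt hqy).ne', x, hp, hfirst, hx⟩
    · rintro ⟨-, x', hx', hfirst', hleft⟩
      rwa [le_antisymm (hfirst _ hx' rfl) (hfirst' _ hp rfl)]
  · have hfirst : ∀ q ∈ A, q.1 = x → y ≤ q.2 := fun q hq hqx =>
      not_lt.mp fun hlt => hno ⟨q, hq, hlt, hqx⟩
    constructor
    · intro hx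
      cases hx with
      | root => exact absurd (h.root_le q hq).1 (not_le.mpr hqx)
      | @step _ x' y' h' hfirst' hy' hfirsty hyr hleft =>
        obtain rfl : y = y' := le_antisymm (hfirst _ hy' rfl) (hfirsty _ hp rfl)
        exact ⟨hyr, x', h', hfirst', hleft⟩
    · rintro ⟨hyr, x', hx', hfirst', hleft⟩
      exact .step hx' hfirst' hp hfirst hyr hleft

/-- The colour of a point is that of the line it shares with its predecessor, so it propagates from
the two prescribed lines of the root. -/
theorem IsTree.colouring_unique (h : IsTree r A) {f g f' g' : ℕ → Prop}
    (hf : IsColouring r A f g) (hf' : IsColouring r A f' g') (p : ℕ × ℕ) (hp : p ∈ A)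
    (hpr : p ≠ r) : f p.1 ↔ f' p.1 := by
  induction hk : p.1 + p.2 using Nat.strong_induction_on generalizing p with
  | _ k ih =>
    rcases (h.xor_prev p hp hpr).or with ⟨q, hq, h1, h2⟩ | ⟨q, hq, h1, h2⟩
    · by_cases hqr : q = r
      · subst hqr
        rw [← h2]
        exact iff_of_true hf.fst_root hf'.fst_root
      · rw [← h2]
        exact ih _ (by omega) q hq hqr rfl
    · rw [hf.iff p hp hpr, hf'.iff p hp hpr]
      by_cases hqr : q = r
      · subst hqr
        rw [← h2]
        exact iff_of_false hf.snd_root hf'.snd_root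
      · rw [← h2, ← hf.iff q hq hqr, ← hf'.iff q hq hqr]
        exact ih _ (by omega) q hq hqr rfl

open scoped Classical in
/-- The points other than the root whose first coordinate has the colour `f`. -/
def colourPart (r : ℕ × ℕ) (A : Finset (ℕ × ℕ)) (f : ℕ → Prop) : Finset (ℕ × ℕ) :=
  {p ∈ A | p ≠ r ∧ f p.1}

theorem mem_colourPart {f : ℕ → Prop} {p : ℕ × ℕ} :
    p ∈ colourPart r A f ↔ p ∈ A ∧ p ≠ r ∧ f p.1 := by
  classical
  rw [colourPart, Finset.mem_filter]

/-- A colour class contains all points of its rows and, except for the root, of its columns.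
Neighbours on a line are thus the same as in `A`, apart from the root in column `r.1`; the next
point of that column becomes the new root. -/
theorem IsTree.exists_isTree_colourPart (h : IsTree r A) (hA : A ≠ {r}) {f g : ℕ → Prop}
    (hf : IsColouring r A f g) : ∃ y, IsTree (r.1, y) (colourPart r A f) := by
  have hcol : ∀ p ∈ colourPart r A f, ∀ q ∈ A, q.2 = p.2 → q ∈ colourPart r A f := by
    intro p hp q hq hqp
    obtain ⟨hpA, hpr, hfp⟩ := mem_colourPart.mp hp
    have hg := (hf.iff p hpA hpr).mp hfp
    rw [← hqp] at hg
    have hqr : q ≠ r := by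
      rintro rfl
      exact hf.snd_root hg
    exact mem_colourPart.mpr ⟨hq, hqr, (hf.iff q hq hqr).mpr hg⟩
  have hrow : ∀ p ∈ colourPart r A f, ∀ q ∈ A, q.1 = p.1 → q ≠ r → q ∈ colourPart r A f := by
    intro p hp q hq hqp hqr
    exact mem_colourPart.mpr ⟨hq, hqr, hqp ▸ (mem_colourPart.mp hp).2.2⟩
  have hsub : ∀ p ∈ colourPart r A f, p ∈ A := fun p hp => (mem_colourPart.mp hp).1
  -- Passing to predecessors stays in the class until column `r.1` is reached, and never increases
  -- the second coordinate.
  have hkey : ∀ p ∈ colourPart r A f, ∃ y ≤ p.2, (r.1, y) ∈ colourPart r A f := by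
    intro p hp
    induction hk : p.1 + p.2 using Nat.strong_induction_on generalizing p with
    | _ k ih =>
      by_cases hpx : p.1 = r.1
      · exact ⟨p.2, le_rfl, by rwa [← hpx]⟩
      · rcases (h.xor_prev p (hsub p hp) (mem_colourPart.mp hp).2.1).or with
          ⟨q, hq, h1, h2⟩ | ⟨q, hq, h1, h2⟩
        · have hqr : q ≠ r := fun e => hpx (by rw [← h2, e])
          obtain ⟨y, hy, hy'⟩ := ih _ (by omega) q (hrow p hp q hq h2 hqr) rfl
          exact ⟨y, hy.trans h1.le, hy'⟩
        · obtain ⟨y, hy, hy'⟩ := ih _ (by omega) q (hcol p hp q hq h2) rfl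
          exact ⟨y, hy.trans h2.le, hy'⟩
  obtain ⟨q, hq, hlt, hqx⟩ := (h.hasNext_root hA).1
  have hq' : q ∈ colourPart r A f :=
    mem_colourPart.mpr ⟨hq, fun e => hlt.ne (by rw [e]), hqx ▸ hf.fst_root⟩
  obtain ⟨q₀, hq₀, hmin⟩ := (Finset.filter (fun p => p.1 = r.1) (colourPart r A f)).exists_min_image
    (fun p => p.2) ⟨q, Finset.mem_filter.mpr ⟨hq', hqx⟩⟩
  obtain ⟨hq₀, hq₀x⟩ := Finset.mem_filter.mp hq₀
  have hroot : (r.1, q₀.2) ∈ colourPart r A f := by rwa [← hq₀x]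
  have hle : ∀ p ∈ colourPart r A f, q₀.2 ≤ p.2 := by
    intro p hp
    obtain ⟨y, hy, hy'⟩ := hkey p hp
    exact (hmin _ (Finset.mem_filter.mpr ⟨hy', rfl⟩)).trans hy
  refine ⟨q₀.2, hroot, fun p hp => ⟨(h.root_le p (hsub p hp)).1, hle p hp⟩, fun p hp hpr => ?_,
    fun p hp => ?_⟩
  · have e1 : HasPrevSnd (colourPart r A f) p ↔ HasPrevSnd A p := by
      refine ⟨fun ⟨q, hq, h⟩ => ⟨q, hsub q hq, h⟩, fun ⟨q, hq, h1, h2⟩ => ?_⟩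
      by_cases hqr : q = r
      · subst hqr
        refine ⟨_, hroot, lt_of_le_of_ne (hle p hp) fun e => hpr ?_, h2⟩
        exact Prod.ext h2.symm e.symm
      · exact ⟨q, hrow p hp q hq h2 hqr, h1, h2⟩
    have e2 : HasPrevFst (colourPart r A f) p ↔ HasPrevFst A p :=
      ⟨fun ⟨q, hq, h⟩ => ⟨q, hsub q hq, h⟩, fun ⟨q, hq, h1, h2⟩ => ⟨q, hcol p hp q hq h2, h1, h2⟩⟩
    rw [e1, e2]
    exact h.xor_prev p (hsub p hp) (mem_colourPart.mp hp).2.1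
  · have e1 : HasNextSnd (colourPart r A f) p ↔ HasNextSnd A p := by
      refine ⟨fun ⟨q, hq, h⟩ => ⟨q, hsub q hq, h⟩, fun ⟨q, hq, h1, h2⟩ => ?_⟩
      have hqr : q ≠ r := fun e =>
        absurd (h.root_le p (hsub p hp)).2 (not_le.mpr (e ▸ h1))
      exact ⟨q, hrow p hp q hq h2 hqr, h1, h2⟩
    have e2 : HasNextFst (colourPart r A f) p ↔ HasNextFst A p :=
      ⟨fun ⟨q, hq, h⟩ => ⟨q, hsub q hq, h⟩, fun ⟨q, hq, h1, h2⟩ => ⟨q, hcol p hp q hq h2, h1, h2⟩⟩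
    rw [e1, e2]
    exact h.next_iff p (hsub p hp)

open scoped Classical in
theorem IsTree.image_fst_colourPart (h : IsTree r A) (hA : A ≠ {r}) {f g : ℕ → Prop}
    (hf : IsColouring r A f g) :
    (colourPart r A f).image Prod.fst = {x ∈ A.image Prod.fst | f x} := by
  ext x
  simp only [Finset.mem_image, Finset.mem_filter, mem_colourPart]
  constructor
  · rintro ⟨p, ⟨hp, -, hfp⟩, rfl⟩
    exact ⟨⟨p, hp, rfl⟩, hfp⟩
  · rintro ⟨⟨p, hp, rfl⟩, hfp⟩
    by_cases hpr : p = r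
    · subst hpr
      obtain ⟨q, hq, hlt, hqx⟩ := (h.hasNext_root hA).1
      exact ⟨q, ⟨hq, fun e => hlt.ne (by rw [e]), hqx ▸ hfp⟩, hqx⟩
    · exact ⟨p, ⟨hp, hpr, hfp⟩, rfl⟩

open scoped Classical in
theorem IsColouring.image_snd_colourPart {f g : ℕ → Prop} (hf : IsColouring r A f g) :
    (colourPart r A f).image Prod.snd = {y ∈ A.image Prod.snd | g y} := by
  ext y
  simp only [Finset.mem_image, Finset.mem_filter, mem_colourPart]
  constructor
  · rintro ⟨p, ⟨hp, hpr, hfp⟩, rfl⟩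
    exact ⟨⟨p, hp, rfl⟩, (hf.iff p hp hpr).mp hfp⟩
  · rintro ⟨⟨p, hp, rfl⟩, hgp⟩
    have hpr : p ≠ r := by
      rintro rfl
      exact hf.snd_root hgp
    exact ⟨p, ⟨hp, hpr, (hf.iff p hp hpr).mpr hgp⟩, rfl⟩

theorem IsColouring.colourPart_swap {f g : ℕ → Prop} (hf : IsColouring r A f g) :
    colourPart r.swap (A.image Prod.swap) (fun y => ¬g y) =
      (colourPart r A fun x => ¬f x).image Prod.swap := by
  ext p
  have hne : p ≠ r.swap ↔ p.swap ≠ r := not_congr ⟨fun e => by rw [e, Prod.swap_swap],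
    fun e => by rw [← e, Prod.swap_swap]⟩
  rw [mem_colourPart, mem_image_swap, mem_image_swap, mem_colourPart, hne]
  exact and_congr_right fun hp => and_congr_right fun hpr => not_congr (hf.iff _ hp hpr).symm

theorem insert_colourPart_union (f : ℕ → Prop) (hr : r ∈ A) :
    insert r (colourPart r A f ∪ colourPart r A fun x => ¬f x) = A := by
  ext p
  rw [Finset.mem_insert, Finset.mem_union, mem_colourPart, mem_colourPart]
  constructor
  · rintro (rfl | h | h)
    · exact hr
    · exact h.1
    · exact h.1
  · intro hp
    tauto

/-! ### Joining two trees -/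

/-- Outside `A₁` only `r` shares a line with it, namely column `r.1`, where `r` comes first. The
only effect is that the old root acquires its one predecessor. -/
theorem IsTree.conditions_of_subset {y : ℕ} (h : IsTree (r.1, y) A₁) (hy : r.2 < y) (hr : r ∈ A)
    (hsub : A₁ ⊆ A)
    (hA : ∀ q ∈ A, q = r ∨ q ∈ A₁ ∨ ∀ p ∈ A₁, q.1 ≠ p.1 ∧ q.2 ≠ p.2) (p : ℕ × ℕ) (hp : p ∈ A₁) :
    Xor (HasPrevSnd A p) (HasPrevFst A p) ∧ (HasNextSnd A p ↔ HasNextFst A p) := by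
  have hyp : r.2 < p.2 := hy.trans_le (h.root_le p hp).2
  have hprevFst : HasPrevFst A p ↔ HasPrevFst A₁ p := by
    refine ⟨fun ⟨q, hq, h1, h2⟩ => ?_, fun ⟨q, hq, h⟩ => ⟨q, hsub hq, h⟩⟩
    rcases hA q hq with rfl | hq | hq
    · exact absurd h2 hyp.ne
    · exact ⟨q, hq, h1, h2⟩
    · exact absurd h2 (hq p hp).2
  have hnextFst : HasNextFst A p ↔ HasNextFst A₁ p := by
    refine ⟨fun ⟨q, hq, h1, h2⟩ => ?_, fun ⟨q, hq, h⟩ => ⟨q, hsub hq, h⟩⟩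
    rcases hA q hq with rfl | hq | hq
    · exact absurd h2 hyp.ne
    · exact ⟨q, hq, h1, h2⟩
    · exact absurd h2 (hq p hp).2
  have hnextSnd : HasNextSnd A p ↔ HasNextSnd A₁ p := by
    refine ⟨fun ⟨q, hq, h1, h2⟩ => ?_, fun ⟨q, hq, h⟩ => ⟨q, hsub hq, h⟩⟩
    rcases hA q hq with rfl | hq | hq
    · exact absurd h1 (lt_asymm hyp)
    · exact ⟨q, hq, h1, h2⟩
    · exact absurd h2 (hq p hp).1
  refine ⟨?_, by rw [hnextSnd, hnextFst]; exact h.next_iff p hp⟩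
  rw [hprevFst]
  by_cases hpr : p = (r.1, y)
  · subst hpr
    refine .inl ⟨⟨r, hr, hy, rfl⟩, ?_⟩
    rintro ⟨q, hq, hlt, -⟩
    exact absurd (h.root_le q hq).1 (not_le.mpr hlt)
  · have hprevSnd : HasPrevSnd A p ↔ HasPrevSnd A₁ p := by
      refine ⟨fun ⟨q, hq, h1, h2⟩ => ?_, fun ⟨q, hq, h⟩ => ⟨q, hsub hq, h⟩⟩
      rcases hA q hq with rfl | hq | hq
      · refine ⟨_, h.root_mem, lt_of_le_of_ne (h.root_le p hp).2 fun e => hpr ?_, h2⟩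
        exact Prod.ext h2.symm e.symm
      · exact ⟨q, hq, h1, h2⟩
      · exact absurd h2 (hq p hp).1
    rw [hprevSnd]
    exact h.xor_prev p hp hpr

theorem IsTree.join {x y : ℕ} (h₁ : IsTree (r.1, y) A₁) (h₂ : IsTree (x, r.2) A₂) (hx : r.1 < x)
    (hy : r.2 < y) (hdisj : ∀ p ∈ A₁, ∀ q ∈ A₂, p.1 ≠ q.1 ∧ p.2 ≠ q.2) :
    IsTree r (insert r (A₁ ∪ A₂)) := by
  set A := insert r (A₁ ∪ A₂)
  have hr : r ∈ A := Finset.mem_insert_self _ _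
  have hs₁ : A₁ ⊆ A := Finset.subset_union_left.trans (Finset.subset_insert _ _)
  have hs₂ : A₂ ⊆ A := Finset.subset_union_right.trans (Finset.subset_insert _ _)
  have hA : ∀ q ∈ A, q = r ∨ q ∈ A₁ ∨ q ∈ A₂ := by
    intro q hq
    rwa [Finset.mem_insert, Finset.mem_union] at hq
  have hc₁ := h₁.conditions_of_subset hy hr hs₁ fun q hq => (hA q hq).imp_right fun h =>
    h.imp_right fun hq p hp => ⟨(hdisj p hp q hq).1.symm, (hdisj p hp q hq).2.symm⟩
  have hc₂ : ∀ p ∈ A₂,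
      Xor (HasPrevSnd A p) (HasPrevFst A p) ∧ (HasNextSnd A p ↔ HasNextFst A p) := by
    intro p hp
    have := h₂.swap.conditions_of_subset (r := r.swap) (A := A.image Prod.swap) hx
      (mem_image_swap.mpr (by simpa using hr)) (Finset.image_subset_image hs₂) (fun q hq => ?_)
      p.swap (mem_image_swap.mpr (by simpa using hp))
    · rw [HasPrevSnd, HasPrevFst, HasNextSnd, HasNextFst, exists_mem_image_swap,
        exists_mem_image_swap, exists_mem_image_swap, exists_mem_image_swap, xor_comm,
        iff_comm] at this
      exact this
    · rcases hA _ (mem_image_swap.mp hq) with h | h | h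
      · exact .inl (by rw [← h, Prod.swap_swap])
      · exact .inr (.inr fun p hp => (hdisj _ h _ (mem_image_swap.mp hp)).symm)
      · exact .inr (.inl (mem_image_swap.mpr h))
  refine ⟨hr, fun p hp => ?_, fun p hp hpr => ?_, fun p hp => ?_⟩
  · rcases hA p hp with rfl | hp | hp
    · exact ⟨le_rfl, le_rfl⟩
    · exact ⟨(h₁.root_le p hp).1, hy.le.trans (h₁.root_le p hp).2⟩
    · exact ⟨hx.le.trans (h₂.root_le p hp).1, (h₂.root_le p hp).2⟩
  · rcases hA p hp with rfl | hp | hp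
    · exact absurd rfl hpr
    · exact (hc₁ p hp).1
    · exact (hc₂ p hp).1
  · rcases hA p hp with rfl | hp | hp
    · exact iff_of_true ⟨_, hs₁ h₁.root_mem, hy, rfl⟩ ⟨_, hs₂ h₂.root_mem, hx, rfl⟩
    · exact (hc₁ p hp).2
    · exact (hc₂ p hp).2

end Tree

/-! ### Counting trees -/

section TreeCount

variable {A A₁ A₂ : Finset (ℕ × ℕ)} {r : ℕ × ℕ} {X Y : Finset ℕ}

theorem image_swap_ne_singleton (hA : A ≠ {r}) : A.image Prod.swap ≠ {r.swap} := by
  intro h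
  apply hA
  rw [← image_swap_image_swap A, h, Finset.image_singleton, Prod.swap_swap]

theorem IsTree.exists_isTree_colourPart_not (h : IsTree r A) (hA : A ≠ {r}) {f g : ℕ → Prop}
    (hf : IsColouring r A f g) : ∃ x, IsTree (x, r.2) (colourPart r A fun x => ¬f x) := by
  obtain ⟨x, hx⟩ := h.swap.exists_isTree_colourPart (image_swap_ne_singleton hA) hf.swap
  rw [hf.colourPart_swap] at hx
  have := hx.swap
  rw [image_swap_image_swap] at this
  exact ⟨x, this⟩

open scoped Classical in
theorem IsTree.image_snd_colourPart_not (h : IsTree r A) (hA : A ≠ {r}) {f g : ℕ → Prop}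
    (hf : IsColouring r A f g) :
    (colourPart r A fun x => ¬f x).image Prod.snd = {y ∈ A.image Prod.snd | ¬g y} := by
  have := h.swap.image_fst_colourPart (image_swap_ne_singleton hA) hf.swap
  rw [hf.colourPart_swap, image_fst_image_swap, image_fst_image_swap] at this
  convert this

open scoped Classical in
theorem IsColouring.image_fst_colourPart_not {f g : ℕ → Prop} (hf : IsColouring r A f g) :
    (colourPart r A fun x => ¬f x).image Prod.fst = {x ∈ A.image Prod.fst | ¬f x} := by
  have := hf.swap.image_snd_colourPart
  rw [hf.colourPart_swap, image_snd_image_swap, image_snd_image_swap] at this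
  convert this

theorem disjoint_colourPart (f : ℕ → Prop) :
    Disjoint (colourPart r A f) (colourPart r A fun x => ¬f x) :=
  Finset.disjoint_left.mpr fun _ h h' => (mem_colourPart.mp h').2.2 (mem_colourPart.mp h).2.2

-- The rows and columns are distributed between the two subtrees. If these have `a` and `b` columns,
-- the number of points is 1 + (2a - 1) + (2b - 1) = 2(a + b) - 1.
open scoped Classical in
theorem IsTree.card_eq (h : IsTree r A) :
    (A.image Prod.fst).card = (A.image Prod.snd).card ∧
      A.card + 1 = 2 * (A.image Prod.fst).card := by
  induction hk : A.card using Nat.strong_induction_on generalizing A r with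
  | _ k ih =>
    by_cases hA : A = {r}
    · subst hA
      simp at hk ⊢
      omega
    · obtain ⟨f, g, hf⟩ := h.exists_isColouring
      obtain ⟨y, h₁⟩ := h.exists_isTree_colourPart hA hf
      obtain ⟨x, h₂⟩ := h.exists_isTree_colourPart_not hA hf
      have hcard : 1 + ((colourPart r A f).card + (colourPart r A fun x => ¬f x).card) = k := by
        rw [← hk, ← Finset.card_union_of_disjoint (disjoint_colourPart f), add_comm,
          ← Finset.card_insert_of_notMem (a := r), insert_colourPart_union f h.root_mem]
        rw [Finset.mem_union, mem_colourPart, mem_colourPart]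
        tauto
      obtain ⟨a1, b1⟩ := ih _ (by omega) h₁ rfl
      obtain ⟨a2, b2⟩ := ih _ (by omega) h₂ rfl
      rw [h.image_fst_colourPart hA hf] at a1 b1
      rw [hf.image_snd_colourPart] at a1
      rw [hf.image_fst_colourPart_not] at a2 b2
      rw [h.image_snd_colourPart_not hA hf] at a2
      have c1 : Finset.card {x ∈ A.image Prod.fst | f x} +
          Finset.card {x ∈ A.image Prod.fst | ¬f x} = (A.image Prod.fst).card := by
        convert Finset.card_filter_add_card_filter_not f
      have c2 : Finset.card {x ∈ A.image Prod.snd | g x} +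
          Finset.card {x ∈ A.image Prod.snd | ¬g x} = (A.image Prod.snd).card := by
        convert Finset.card_filter_add_card_filter_not g
      omega

open scoped Classical in
/-- The trees whose points have first coordinates `X` and second coordinates `Y`. -/
def treesOn (X Y : Finset ℕ) : Finset (Finset (ℕ × ℕ)) :=
  {A ∈ (X ×ˢ Y).powerset | A.image Prod.fst = X ∧ A.image Prod.snd = Y ∧ ∃ r, IsTree r A}

theorem mem_treesOn : A ∈ treesOn X Y ↔
    A.image Prod.fst = X ∧ A.image Prod.snd = Y ∧ ∃ r, IsTree r A := by
  classical
  rw [treesOn, Finset.mem_filter, Finset.mem_powerset]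
  refine ⟨fun h => h.2, fun h => ⟨fun p hp => Finset.mem_product.mpr ⟨?_, ?_⟩, h⟩⟩
  · exact h.1 ▸ Finset.mem_image_of_mem _ hp
  · exact h.2.1 ▸ Finset.mem_image_of_mem _ hp

theorem fst_mem_of_mem_treesOn (h : A ∈ treesOn X Y) {p : ℕ × ℕ} (hp : p ∈ A) : p.1 ∈ X :=
  (mem_treesOn.mp h).1 ▸ Finset.mem_image_of_mem _ hp

theorem snd_mem_of_mem_treesOn (h : A ∈ treesOn X Y) {p : ℕ × ℕ} (hp : p ∈ A) : p.2 ∈ Y :=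
  (mem_treesOn.mp h).2.1 ▸ Finset.mem_image_of_mem _ hp

theorem card_eq_of_mem_treesOn (h : A ∈ treesOn X Y) : X.card = Y.card := by
  obtain ⟨h1, h2, r, hr⟩ := mem_treesOn.mp h
  rw [← h1, ← h2, hr.card_eq.1]

theorem IsTree.root_fst_eq (h : IsTree r A) (hX : A.image Prod.fst = X) {x : ℕ} (hx : x ∈ X)
    (hmin : ∀ x' ∈ X, x ≤ x') : r.1 = x := by
  refine le_antisymm ?_ (hmin _ (hX ▸ Finset.mem_image_of_mem _ h.root_mem))
  rw [← hX] at hx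
  obtain ⟨p, hp, rfl⟩ := Finset.mem_image.mp hx
  exact (h.root_le p hp).1

theorem IsTree.root_snd_eq (h : IsTree r A) (hY : A.image Prod.snd = Y) {y : ℕ} (hy : y ∈ Y)
    (hmin : ∀ y' ∈ Y, y ≤ y') : r.2 = y := by
  refine h.swap.root_fst_eq (X := Y) ?_ hy hmin
  rw [image_fst_image_swap, hY]

theorem singleton_mem_treesOn {p : ℕ × ℕ} : {p} ∈ treesOn X Y ↔ X = {p.1} ∧ Y = {p.2} := by
  rw [mem_treesOn, Finset.image_singleton, Finset.image_singleton]
  exact ⟨fun h => ⟨h.1.symm, h.2.1.symm⟩, fun h => ⟨h.1.symm, h.2.symm, p, isTree_singleton p⟩⟩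

theorem isColouring_of_mem_treesOn {x y : ℕ} {X₁ Y₁ : Finset ℕ} (hxX : x ∈ X₁) (hyY : y ∉ Y₁)
    (h₁ : A₁ ∈ treesOn X₁ Y₁) (h₂ : A₂ ∈ treesOn (X \ X₁) (Y \ Y₁)) :
    IsColouring (x, y) (insert (x, y) (A₁ ∪ A₂)) (· ∈ X₁) (· ∈ Y₁) where
  fst_root := hxX
  snd_root := hyY
  iff := by
    intro p hp hpr
    rcases Finset.mem_union.mp ((Finset.mem_insert.mp hp).resolve_left hpr) with hp | hp
    · exact iff_of_true (fst_mem_of_mem_treesOn h₁ hp) (snd_mem_of_mem_treesOn h₁ hp)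
    · exact iff_of_false (Finset.mem_sdiff.mp (fst_mem_of_mem_treesOn h₂ hp)).2
        (Finset.mem_sdiff.mp (snd_mem_of_mem_treesOn h₂ hp)).2

theorem colourPart_insert_union {x y : ℕ} {X₁ Y₁ : Finset ℕ} (hyY : y ∉ Y₁)
    (h₁ : A₁ ∈ treesOn X₁ Y₁) (h₂ : A₂ ∈ treesOn (X \ X₁) (Y \ Y₁)) :
    colourPart (x, y) (insert (x, y) (A₁ ∪ A₂)) (· ∈ X₁) = A₁ := by
  ext p
  rw [mem_colourPart, Finset.mem_insert, Finset.mem_union]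
  constructor
  · rintro ⟨hp | hp | hp, hpr, hpX⟩
    · exact absurd hp hpr
    · exact hp
    · exact absurd hpX (Finset.mem_sdiff.mp (fst_mem_of_mem_treesOn h₂ hp)).2
  · intro hp
    refine ⟨.inr (.inl hp), ?_, fst_mem_of_mem_treesOn h₁ hp⟩
    rintro rfl
    exact hyY (snd_mem_of_mem_treesOn h₁ hp)

theorem colourPart_not_insert_union {x y : ℕ} {X₁ Y₁ : Finset ℕ} (hxX : x ∈ X₁)
    (h₁ : A₁ ∈ treesOn X₁ Y₁) (h₂ : A₂ ∈ treesOn (X \ X₁) (Y \ Y₁)) :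
    colourPart (x, y) (insert (x, y) (A₁ ∪ A₂)) (· ∉ X₁) = A₂ := by
  ext p
  rw [mem_colourPart, Finset.mem_insert, Finset.mem_union]
  constructor
  · rintro ⟨hp | hp | hp, hpr, hpX⟩
    · exact absurd hp hpr
    · exact absurd (fst_mem_of_mem_treesOn h₁ hp) hpX
    · exact hp
  · intro hp
    have := (Finset.mem_sdiff.mp (fst_mem_of_mem_treesOn h₂ hp)).2
    refine ⟨.inr (.inr hp), ?_, this⟩
    rintro rfl
    exact this hxX

theorem insert_union_mem_treesOn {x y : ℕ} (hx : x ∈ X) (hxmin : ∀ x' ∈ X, x ≤ x') (hy : y ∈ Y)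
    (hymin : ∀ y' ∈ Y, y ≤ y') {X₁ Y₁ : Finset ℕ} (hX : X₁ ⊆ X) (hxX : x ∈ X₁) (hY : Y₁ ⊆ Y)
    (hyY : y ∉ Y₁) (h₁ : A₁ ∈ treesOn X₁ Y₁) (h₂ : A₂ ∈ treesOn (X \ X₁) (Y \ Y₁)) :
    insert (x, y) (A₁ ∪ A₂) ∈ treesOn X Y ∧ insert (x, y) (A₁ ∪ A₂) ≠ {(x, y)} := by
  obtain ⟨i₁, j₁, ⟨a₁, b₁⟩, t₁⟩ := mem_treesOn.mp h₁
  obtain ⟨i₂, j₂, ⟨a₂, b₂⟩, t₂⟩ := mem_treesOn.mp h₂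
  obtain rfl : a₁ = x := t₁.root_fst_eq i₁ hxX fun x' hx' => hxmin x' (hX hx')
  obtain rfl : b₂ = y := t₂.root_snd_eq j₂ (Finset.mem_sdiff.mpr ⟨hy, hyY⟩) fun y' hy' =>
    hymin y' (Finset.mem_sdiff.mp hy').1
  have ha₂ := Finset.mem_sdiff.mp (fst_mem_of_mem_treesOn h₂ t₂.root_mem)
  have hb₁ := snd_mem_of_mem_treesOn h₁ t₁.root_mem
  have hlt₁ : a₁ < a₂ := lt_of_le_of_ne (hxmin _ ha₂.1) fun e => ha₂.2 (by rwa [← e])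
  have hlt₂ : b₂ < b₁ := lt_of_le_of_ne (hymin _ (hY hb₁)) fun e => hyY (by rwa [e])
  refine ⟨mem_treesOn.mpr ⟨?_, ?_, (a₁, b₂), t₁.join (r := (a₁, b₂)) t₂ hlt₁ hlt₂ ?_⟩, ?_⟩
  · rw [Finset.image_insert, Finset.image_union, i₁, i₂, Finset.union_sdiff_of_subset hX,
      Finset.insert_eq_of_mem hx]
  · rw [Finset.image_insert, Finset.image_union, j₁, j₂, Finset.union_sdiff_of_subset hY,
      Finset.insert_eq_of_mem hy]
  · intro p hp q hq
    have hq1 := (Finset.mem_sdiff.mp (fst_mem_of_mem_treesOn h₂ hq)).2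
    have hq2 := (Finset.mem_sdiff.mp (snd_mem_of_mem_treesOn h₂ hq)).2
    exact ⟨fun e => hq1 (e ▸ fst_mem_of_mem_treesOn h₁ hp),
      fun e => hq2 (e ▸ snd_mem_of_mem_treesOn h₁ hp)⟩
  · intro e
    have : (a₁, b₁) ∈ ({(a₁, b₂)} : Finset (ℕ × ℕ)) :=
      e ▸ Finset.mem_insert_of_mem (Finset.mem_union_left _ t₁.root_mem)
    rw [Finset.mem_singleton, Prod.mk.injEq] at this
    exact hlt₂.ne' this.2

theorem exists_eq_insert_union {x y : ℕ} (hx : x ∈ X) (hxmin : ∀ x' ∈ X, x ≤ x') (hy : y ∈ Y)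
    (hymin : ∀ y' ∈ Y, y ≤ y') (hA : A ∈ treesOn X Y) (hne : A ≠ {(x, y)}) :
    ∃ U ⊆ X.erase x, ∃ V ⊆ Y.erase y, ∃ A₁ ∈ treesOn (insert x U) V,
      ∃ A₂ ∈ treesOn (X \ insert x U) (Y \ V), insert (x, y) (A₁ ∪ A₂) = A := by
  classical
  obtain ⟨rfl, rfl, ⟨a, b⟩, t⟩ := mem_treesOn.mp hA
  obtain rfl : a = x := t.root_fst_eq rfl hx hxmin
  obtain rfl : b = y := t.root_snd_eq rfl hy hymin
  obtain ⟨f, g, hf⟩ := t.exists_isColouring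
  have hins : insert a (((A.image Prod.fst).filter f).erase a) = (A.image Prod.fst).filter f :=
    Finset.insert_erase (Finset.mem_filter.mpr ⟨hx, hf.fst_root⟩)
  refine ⟨((A.image Prod.fst).filter f).erase a,
    Finset.erase_subset_erase _ (Finset.filter_subset _ _), (A.image Prod.snd).filter g,
    fun y hy => ?_, colourPart (a, b) A f, ?_, colourPart (a, b) A fun x => ¬f x, ?_,
    insert_colourPart_union f t.root_mem⟩
  · obtain ⟨hy, hgy⟩ := Finset.mem_filter.mp hy
    exact Finset.mem_erase.mpr ⟨fun e => hf.snd_root (e ▸ hgy), hy⟩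
  · rw [hins]
    obtain ⟨c, hc⟩ := t.exists_isTree_colourPart hne hf
    exact mem_treesOn.mpr ⟨t.image_fst_colourPart hne hf, hf.image_snd_colourPart, _, hc⟩
  · rw [hins, ← Finset.filter_not, ← Finset.filter_not]
    obtain ⟨c, hc⟩ := t.exists_isTree_colourPart_not hne hf
    exact mem_treesOn.mpr ⟨hf.image_fst_colourPart_not, t.image_snd_colourPart_not hne hf, _, hc⟩

/-- A tree is a single point, or a root with two trees on complementary sets of lines. Column `x`
remains with the first tree and row `y` with the second, whence the choices of `U` and `V`.
Uniqueness of the colouring makes the decomposition unique. -/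
theorem card_treesOn {x y : ℕ} (hx : x ∈ X) (hxmin : ∀ x' ∈ X, x ≤ x') (hy : y ∈ Y)
    (hymin : ∀ y' ∈ Y, y ≤ y') :
    (treesOn X Y).card = (if X = {x} ∧ Y = {y} then 1 else 0) +
      ∑ U ∈ (X.erase x).powerset, ∑ V ∈ (Y.erase y).powerset,
        (treesOn (insert x U) V).card * (treesOn (X \ insert x U) (Y \ V)).card := by
  have hsub : ∀ {U V}, U ⊆ X.erase x → V ⊆ Y.erase y →
      insert x U ⊆ X ∧ x ∈ insert x U ∧ V ⊆ Y ∧ y ∉ V := fun hU hV =>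
    ⟨Finset.insert_subset hx (hU.trans (Finset.erase_subset _ _)), Finset.mem_insert_self _ _,
      hV.trans (Finset.erase_subset _ _), fun h => Finset.notMem_erase _ _ (hV h)⟩
  have hone : Finset.card {A ∈ treesOn X Y | A = {(x, y)}} =
      if X = {x} ∧ Y = {y} then 1 else 0 := by
    rw [Finset.filter_eq', apply_ite Finset.card, Finset.card_singleton, Finset.card_empty]
    exact if_congr singleton_mem_treesOn rfl rfl
  rw [← Finset.card_filter_add_card_filter_not (s := treesOn X Y) (fun A => A = {(x, y)}), hone,
    add_right_inj]
  have hsum : (∑ U ∈ (X.erase x).powerset, ∑ V ∈ (Y.erase y).powerset,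
      (treesOn (insert x U) V).card * (treesOn (X \ insert x U) (Y \ V)).card) =
      (((X.erase x).powerset ×ˢ (Y.erase y).powerset).sigma fun z =>
        treesOn (insert x z.1) z.2 ×ˢ treesOn (X \ insert x z.1) (Y \ z.2)).card := by
    rw [Finset.card_sigma, Finset.sum_product]
    simp only [Finset.card_product]
  rw [hsum]
  symm
  refine Finset.card_bij (fun w _ => insert (x, y) (w.2.1 ∪ w.2.2)) ?_ ?_ ?_
  · rintro ⟨⟨U, V⟩, A₁, A₂⟩ h
    simp only [Finset.mem_sigma, Finset.mem_product, Finset.mem_powerset] at h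
    obtain ⟨⟨hU, hV⟩, h₁, h₂⟩ := h
    obtain ⟨a, b, c, d⟩ := hsub hU hV
    exact Finset.mem_filter.mpr (insert_union_mem_treesOn hx hxmin hy hymin a b c d h₁ h₂)
  · rintro ⟨⟨U, V⟩, A₁, A₂⟩ h ⟨⟨U', V'⟩, A₁', A₂'⟩ h' heq
    simp only [Finset.mem_sigma, Finset.mem_product, Finset.mem_powerset] at h h'
    obtain ⟨⟨hU, hV⟩, h₁, h₂⟩ := h
    obtain ⟨⟨hU', hV'⟩, h₁', h₂'⟩ := h'
    dsimp only at heq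
    obtain ⟨a, b, c, d⟩ := hsub hU hV
    obtain ⟨a', b', c', d'⟩ := hsub hU' hV'
    obtain ⟨hA, -⟩ := insert_union_mem_treesOn hx hxmin hy hymin a b c d h₁ h₂
    obtain ⟨i, j, r, t⟩ := mem_treesOn.mp hA
    obtain rfl : r = (x, y) :=
      Prod.ext (t.root_fst_eq i hx hxmin) (t.root_snd_eq j hy hymin)
    have k := isColouring_of_mem_treesOn b d h₁ h₂
    have k' := isColouring_of_mem_treesOn b' d' h₁' h₂'
    rw [← heq] at k'
    have hu := t.colouring_unique k k'
    have e₁ : A₁ = A₁' := by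
      rw [← colourPart_insert_union (x := x) d h₁ h₂,
        ← colourPart_insert_union (x := x) d' h₁' h₂', ← heq]
      ext p
      rw [mem_colourPart, mem_colourPart]
      exact and_congr_right fun hp => and_congr_right fun hpr => hu p hp hpr
    have e₂ : A₂ = A₂' := by
      rw [← colourPart_not_insert_union (y := y) b h₁ h₂,
        ← colourPart_not_insert_union (y := y) b' h₁' h₂', ← heq]
      ext p
      rw [mem_colourPart, mem_colourPart]
      exact and_congr_right fun hp => and_congr_right fun hpr => not_congr (hu p hp hpr)
    have hins : insert x U = insert x U' := by
      rw [← (mem_treesOn.mp h₁).1, ← (mem_treesOn.mp h₁').1, e₁]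
    have eU : U = U' := by
      rw [← Finset.erase_insert fun h => Finset.notMem_erase _ _ (hU h), hins,
        Finset.erase_insert fun h => Finset.notMem_erase _ _ (hU' h)]
    have eV : V = V' := by rw [← (mem_treesOn.mp h₁).2.1, ← (mem_treesOn.mp h₁').2.1, e₁]
    rw [eU, eV, e₁, e₂]
  · intro A hA
    rw [Finset.mem_filter] at hA
    obtain ⟨U, hU, V, hV, A₁, h₁, A₂, h₂, rfl⟩ :=
      exists_eq_insert_union hx hxmin hy hymin hA.1 hA.2
    refine ⟨⟨(U, V), A₁, A₂⟩, ?_, rfl⟩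
    simp only [Finset.mem_sigma, Finset.mem_product, Finset.mem_powerset]
    exact ⟨⟨hU, hV⟩, h₁, h₂⟩

theorem rNumber_zero (Q : ℕ → Type) [∀ n, PartialOrder (Q n)] : rNumber Q 0 = 0 := by
  have h := PowerSeries.constantCoeff_logOf (constantCoeff_alternatingSeries Q)
  rw [PowerSeries.logOf_eq] at h
  rw [rNumber, negLogSeries, map_neg, PowerSeries.coeff_zero_eq_constantCoeff_apply, h]
  simp

/-- The decomposition at the root, sorted by the sizes of `U` and `V`, is the quadratic recursion
for r = 2. -/
theorem card_treesOn_eq_rNumber (n : ℕ) (X Y : Finset ℕ) (hX : X.card = n) (hY : Y.card = n) :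
    ((treesOn X Y).card : ℚ) = rNumber (RPartition 2) n := by
  induction n using Nat.strong_induction_on generalizing X Y with
  | _ n ih =>
    rcases n with _ | n
    · rw [rNumber_zero, Nat.cast_eq_zero, Finset.card_eq_zero, Finset.eq_empty_iff_forall_notMem]
      intro A hA
      obtain ⟨-, -, r, h⟩ := mem_treesOn.mp hA
      have := fst_mem_of_mem_treesOn hA h.root_mem
      rw [Finset.card_eq_zero.mp hX] at this
      exact absurd this (Finset.notMem_empty _)
    have hXne : X.Nonempty := Finset.card_pos.mp (by omega)
    have hYne : Y.Nonempty := Finset.card_pos.mp (by omega)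
    have hx := X.min'_mem hXne
    have hy := Y.min'_mem hYne
    rw [card_treesOn hx (X.min'_le) hy (Y.min'_le),
      rNumber_quadratic_recursion _ (numMinimal_rPartition 1)]
    set x := X.min' hXne
    set y := Y.min' hYne
    have hX' : (X.erase x).card = n := by rw [Finset.card_erase_of_mem hx, hX]; rfl
    have hY' : (Y.erase y).card = n := by rw [Finset.card_erase_of_mem hy, hY]; rfl
    rw [Nat.cast_add]
    congr 1
    · have : X = {x} ∧ Y = {y} ↔ n = 0 := by
        constructor
        · rintro ⟨h, -⟩
          rw [h, Finset.card_singleton] at hX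
          omega
        · rintro rfl
          obtain ⟨a, ha⟩ := Finset.card_eq_one.mp hX
          obtain ⟨b, hb⟩ := Finset.card_eq_one.mp hY
          have hxa : x = a := Finset.mem_singleton.mp (ha ▸ hx)
          have hyb : y = b := Finset.mem_singleton.mp (hb ▸ hy)
          exact ⟨hxa ▸ ha, hyb ▸ hb⟩
      by_cases h0 : n = 0
      · rw [if_pos h0, if_pos (this.mpr h0), Nat.cast_one]
      · rw [if_neg h0, if_neg (mt this.mp h0), Nat.cast_zero]
    -- A tree meets as many rows as columns, so only |V| = |U| + 1 contributes.
    · let F (i j : ℕ) : ℚ := if j = i + 1 then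
        rNumber (RPartition 2) (i + 1) * rNumber (RPartition 2) (n - i) else 0
      have hF : ∀ U ∈ (X.erase x).powerset, ∀ V ∈ (Y.erase y).powerset,
          (((treesOn (insert x U) V).card * (treesOn (X \ insert x U) (Y \ V)).card : ℕ) : ℚ) =
            F U.card V.card := by
        intro U hU V hV
        rw [Finset.mem_powerset] at hU hV
        have hxU : (insert x U).card = U.card + 1 :=
          Finset.card_insert_of_notMem fun h => Finset.notMem_erase _ _ (hU h)
        have hVn := Finset.card_le_card hV
        rw [hY'] at hVn
        simp only [F]
        split_ifs with hc
        · rw [Nat.cast_mul, ih (U.card + 1) (by omega) _ _ hxU hc,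
            ih (n - U.card) (by omega) _ _ ?_ ?_]
          · rw [Finset.card_sdiff_of_subset (Finset.insert_subset hx
              (hU.trans (Finset.erase_subset _ _))), hX, hxU]
            omega
          · rw [Finset.card_sdiff_of_subset (hV.trans (Finset.erase_subset _ _)), hY, hc]
            omega
        · rw [Finset.card_eq_zero.mpr (Finset.eq_empty_iff_forall_notMem.mpr fun A hA => hc ?_),
            zero_mul, Nat.cast_zero]
          rw [← card_eq_of_mem_treesOn hA, hxU]
      rw [Nat.cast_sum, Finset.Nat.sum_antidiagonal_eq_sum_range_succ_mk,
        Finset.sum_congr rfl fun U hU => by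
          rw [Nat.cast_sum, Finset.sum_congr rfl (hF U hU),
            Finset.sum_powerset_apply_card (fun j => F U.card j), hY'],
        Finset.sum_powerset_apply_card
          (fun i => ∑ j ∈ Finset.range (n + 1), n.choose j • F i j), hX']
      refine Finset.sum_congr rfl fun i hi => ?_
      simp only [F, smul_ite, smul_zero]
      rw [Finset.sum_ite_eq', nsmul_eq_mul, nsmul_eq_mul]
      split_ifs with h
      · ring
      · rw [Finset.mem_range] at h hi
        rw [show n.choose (i + 1) = 0 from Nat.choose_eq_zero_of_lt (by omega)]
        simp

/-! ### Complete non-ambiguous trees as trees on intervals -/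

/-- The only possible children are the next point in the column and the next point in the row, and
these are distinct. Their number is 0 or 2 exactly when both or neither exist. -/
theorem ncard_children (A : Finset (ℕ × ℕ)) {v : ℕ × ℕ} (hv : v ∈ A) :
    (Set.ncard {p | IsChild A p v} = 0 ∨ Set.ncard {p | IsChild A p v} = 2) ↔
      (HasNextSnd A v ↔ HasNextFst A v) := by
  let D₁ : Set (ℕ × ℕ) := {p | p ∈ A ∧ v.1 = p.1 ∧ v.2 < p.2 ∧
    ∀ t ∈ A, t.1 = p.1 → t.2 < p.2 → t.2 ≤ v.2}
  let D₂ : Set (ℕ × ℕ) := {p | p ∈ A ∧ v.2 = p.2 ∧ v.1 < p.1 ∧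
    ∀ t ∈ A, t.2 = p.2 → t.1 < p.1 → t.1 ≤ v.1}
  have hD : {p | IsChild A p v} = D₁ ∪ D₂ := by
    ext p
    simp only [IsChild, D₁, D₂, Set.mem_ofPred_eq, Set.mem_union]
    tauto
  have hf₁ : D₁.Finite := A.finite_toSet.subset fun p hp => hp.1
  have hf₂ : D₂.Finite := A.finite_toSet.subset fun p hp => hp.1
  have hdisj : Disjoint D₁ D₂ := Set.disjoint_left.mpr fun p hp hp' => hp'.2.2.1.ne hp.2.1
  have hs₁ : D₁.Subsingleton := by
    rintro p ⟨hp, h1, h2, h3⟩ q ⟨hq, k1, k2, k3⟩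
    refine Prod.ext (h1.symm.trans k1) (le_antisymm ?_ ?_)
    · exact not_lt.mp fun h => absurd (h3 q hq (k1.symm.trans h1) h) (not_le.mpr k2)
    · exact not_lt.mp fun h => absurd (k3 p hp (h1.symm.trans k1) h) (not_le.mpr h2)
  have hs₂ : D₂.Subsingleton := by
    rintro p ⟨hp, h1, h2, h3⟩ q ⟨hq, k1, k2, k3⟩
    refine Prod.ext (le_antisymm ?_ ?_) (h1.symm.trans k1)
    · exact not_lt.mp fun h => absurd (h3 q hq (k1.symm.trans h1) h) (not_le.mpr k2)
    · exact not_lt.mp fun h => absurd (k3 p hp (h1.symm.trans k1) h) (not_le.mpr h2)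
  have hn₁ : D₁.Nonempty ↔ HasNextSnd A v := by
    constructor
    · rintro ⟨p, hp, h1, h2, -⟩
      exact ⟨p, hp, h2, h1.symm⟩
    · rintro ⟨q, hq, h1, h2⟩
      obtain ⟨p, hp, hmin⟩ := (A.filter fun p => v.2 < p.2 ∧ p.1 = v.1).exists_min_image
        (fun p => p.2) ⟨q, Finset.mem_filter.mpr ⟨hq, h1, h2⟩⟩
      obtain ⟨hp, hlt, hpv⟩ := Finset.mem_filter.mp hp
      refine ⟨p, hp, hpv.symm, hlt, fun t ht htp htlt => not_lt.mp fun h => ?_⟩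
      exact absurd (hmin t (Finset.mem_filter.mpr ⟨ht, h, htp.trans hpv⟩)) (not_le.mpr htlt)
  have hn₂ : D₂.Nonempty ↔ HasNextFst A v := by
    constructor
    · rintro ⟨p, hp, h1, h2, -⟩
      exact ⟨p, hp, h2, h1.symm⟩
    · rintro ⟨q, hq, h1, h2⟩
      obtain ⟨p, hp, hmin⟩ := (A.filter fun p => v.1 < p.1 ∧ p.2 = v.2).exists_min_image
        (fun p => p.1) ⟨q, Finset.mem_filter.mpr ⟨hq, h1, h2⟩⟩
      obtain ⟨hp, hlt, hpv⟩ := Finset.mem_filter.mp hp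
      refine ⟨p, hp, hpv.symm, hlt, fun t ht htp htlt => not_lt.mp fun h => ?_⟩
      exact absurd (hmin t (Finset.mem_filter.mpr ⟨ht, h, htp.trans hpv⟩)) (not_le.mpr htlt)
  rw [hD, Set.ncard_union_eq hdisj hf₁ hf₂, ← hn₁, ← hn₂]
  rcases hs₁.eq_empty_or_singleton with h₁ | ⟨a, h₁⟩ <;>
    rcases hs₂.eq_empty_or_singleton with h₂ | ⟨b, h₂⟩ <;> simp [h₁, h₂]

theorem isCompleteNonAmbiguousTree_iff :
    IsCompleteNonAmbiguousTree A ↔ IsTree (0, 0) A ∧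
      (∀ p ∈ A, ∀ x' < p.1, ∃ q ∈ A, q.1 = x') ∧ (∀ p ∈ A, ∀ y' < p.2, ∃ q ∈ A, q.2 = y') := by
  constructor
  · rintro ⟨h, hc⟩
    exact ⟨⟨h.root_mem, fun p _ => ⟨Nat.zero_le _, Nat.zero_le _⟩, h.xor_before,
      fun p hp => (ncard_children A hp).mp (hc p hp)⟩, h.no_gap_fst, h.no_gap_snd⟩
  · rintro ⟨h, h1, h2⟩
    exact ⟨⟨h.root_mem, h.xor_prev, h1, h2⟩, fun v hv =>
      (ncard_children A hv).mpr (h.next_iff v hv)⟩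

theorem eq_range_card_of_forall_lt_mem {X : Finset ℕ} (h : ∀ x ∈ X, ∀ x' < x, x' ∈ X) :
    X = Finset.range X.card := by
  refine Finset.eq_of_subset_of_card_le (fun x hx => ?_) (Finset.card_range _).le
  rw [Finset.mem_range]
  have : Finset.range (x + 1) ⊆ X := fun y hy => by
    rcases (Nat.lt_succ_iff.mp (Finset.mem_range.mp hy)).eq_or_lt with rfl | hlt
    · exact hx
    · exact h x hx y hlt
  simpa using Finset.card_le_card this

/-- Absence of gaps makes the coordinate sets initial segments of ℕ, and `IsTree.card_eq` translates
2n - 1 points into `n` rows and `n` columns. -/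
theorem isCompleteNonAmbiguousTree_and_card_iff {n : ℕ} (hn : 1 ≤ n) :
    IsCompleteNonAmbiguousTree A ∧ A.card = 2 * n - 1 ↔
      A ∈ treesOn (Finset.range n) (Finset.range n) := by
  rw [isCompleteNonAmbiguousTree_iff, mem_treesOn]
  constructor
  · rintro ⟨⟨h, h1, h2⟩, hcard⟩
    obtain ⟨c1, c2⟩ := h.card_eq
    have hn' : (A.image Prod.fst).card = n := by omega
    refine ⟨?_, ?_, _, h⟩
    · rw [← hn']
      refine eq_range_card_of_forall_lt_mem fun x hx x' hlt => ?_
      obtain ⟨p, hp, rfl⟩ := Finset.mem_image.mp hx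
      exact Finset.mem_image.mpr (h1 p hp x' hlt)
    · rw [← hn', c1]
      refine eq_range_card_of_forall_lt_mem fun x hx x' hlt => ?_
      obtain ⟨p, hp, rfl⟩ := Finset.mem_image.mp hx
      exact Finset.mem_image.mpr (h2 p hp x' hlt)
  · rintro ⟨hX, hY, r, h⟩
    obtain rfl : r = (0, 0) := Prod.ext
      (h.root_fst_eq hX (Finset.mem_range.mpr hn) fun _ _ => Nat.zero_le _)
      (h.root_snd_eq hY (Finset.mem_range.mpr hn) fun _ _ => Nat.zero_le _)
    have hcard := h.card_eq.2
    rw [hX, Finset.card_range] at hcard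
    refine ⟨⟨h, fun p hp x' hlt => ?_, fun p hp y' hlt => ?_⟩, by omega⟩
    · have hp' : p.1 ∈ Finset.range n := hX ▸ Finset.mem_image_of_mem _ hp
      have : x' ∈ A.image Prod.fst := by
        rw [hX]
        exact Finset.mem_range.mpr (hlt.trans (Finset.mem_range.mp hp'))
      exact Finset.mem_image.mp this
    · have hp' : p.2 ∈ Finset.range n := hY ▸ Finset.mem_image_of_mem _ hp
      have : y' ∈ A.image Prod.snd := by
        rw [hY]
        exact Finset.mem_range.mpr (hlt.trans (Finset.mem_range.mp hp'))
      exact Finset.mem_image.mp this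

theorem finite_completeNonAmbiguousTree_and_rNumber_eq {n : ℕ} (hn : 1 ≤ n) :
    Finite (CompleteNonAmbiguousTree (2 * n - 1)) ∧
      rNumber (RPartition 2) n = (Nat.card (CompleteNonAmbiguousTree (2 * n - 1)) : ℚ) := by
  let e : CompleteNonAmbiguousTree (2 * n - 1) ≃
      {A // A ∈ treesOn (Finset.range n) (Finset.range n)} :=
    Equiv.subtypeEquivRight fun A => isCompleteNonAmbiguousTree_and_card_iff hn
  refine ⟨Finite.of_equiv _ e.symm, ?_⟩
  rw [Nat.card_congr e, Nat.card_eq_fintype_card, Fintype.card_coe,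
    card_treesOn_eq_rNumber n _ _ (Finset.card_range n) (Finset.card_range n)]

end TreeCount

end PathHeap

end

/-! ### The theorem: comparison of pyramids and trees through their common number. -/

theorem mainTheorem2 (n : ℕ) (hn : 1 ≤ n) :
    (∀ r : ℕ, 1 ≤ r →
      Finite (PathHeap.PathPyramid r n) ∧
        PathHeap.rNumber (PathHeap.RPartition r) n = (Nat.card (PathHeap.PathPyramid r n) : ℚ)) ∧
    (Finite (PathHeap.CompleteNonAmbiguousTree (2 * n - 1)) ∧
      PathHeap.rNumber (PathHeap.RPartition 2) n =
        (Nat.card (PathHeap.CompleteNonAmbiguousTree (2 * n - 1)) : ℚ) ∧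
      Nonempty (PathHeap.CompleteNonAmbiguousTree (2 * n - 1) ≃ PathHeap.PathPyramid 2 n)) := by
  have h : ∀ r : ℕ, 1 ≤ r → Finite (PathHeap.PathPyramid r n) ∧
      PathHeap.rNumber (PathHeap.RPartition r) n = (Nat.card (PathHeap.PathPyramid r n) : ℚ) := by
    intro r hr
    obtain ⟨s, rfl⟩ := Nat.exists_eq_add_of_le' hr
    exact PathHeap.finite_pathPyramid_and_rNumber_eq s hn
  obtain ⟨h1, h2⟩ := h 2 one_le_two
  obtain ⟨h3, h4⟩ := PathHeap.finite_completeNonAmbiguousTree_and_rNumber_eq hn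
  refine ⟨h, h3, h4, ?_⟩
  have hcard : Nat.card (PathHeap.CompleteNonAmbiguousTree (2 * n - 1)) =
      Nat.card (PathHeap.PathPyramid 2 n) := by
    exact_mod_cast h4.symm.trans h2
  exact ⟨(Finite.equivFin _).trans ((finCongr hcard).trans (Finite.equivFin _).symm)⟩
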